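/- Let $x_1,\dots,x_n,z$ be variables with finite domains $D_1,\dots,D_n,D_z$ of integers, let $m=\sum_{i=1}^n |D_i|$, and let $$\mathrm{softalldiff}(x_1,\dots,x_n,z)=\{(d_1,\dots,d_n,\tilde d)\mid d_i\in D_i,\ \tilde d\in D_z,\ |\{(i,j)\mid i<j,\ d_i=d_j\}|\le \tilde d\}.$$ Let $G$ be the directed multigraph with vertex set $\{s,t\}\cup\{x_1,\dots,x_n\}\cup\bigcup_i D_i$ and with the following arcs, all of capacity $1$: an arc $(s,x_i)$ of cost $0$ for each $i$; an arc $(x_i,d)$ of cost $0$ for each $i$ and each $d\in D_i$; and, for each value $d$ that lies in exactly $k\ge 1$ of the domains $D_1,\dots,D_n$, parallel arcs $(d,t)_0,\dots,(d,t)_{k-1}$, where $(d,t)_j$ has cost $j$. A minimum-cost flow in $G$ is a feasible $s$–$t$ flow of maximum value and, among those, of minimum cost. A constraint is hyper-arc consistent if every value in the domain of each of its variables occurs in some tuple of the constraint. Suppose that $\mathrm{softalldiff}(x_1,\dots,x_n,z)$ is consistent (that is, nonempty) and that an integer minimum-cost flow $f$ in $G$ is given. Then $\mathrm{softalldiff}(x_1,\dots,x_n,z)$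 can be made hyper-arc consistent in $O(m)$ time: there is a single algorithm (a program for a unit-cost random access machine with integer words, addition, subtraction and comparison) that, given the pairs $(x_i,d)$ with $d\in D_i$ in any order, the flow on the corresponding arcs, and $\min D_z$ and $\max D_z$, performs $O(m)$ steps and determines which values to remove from each $D_i$ and a new lower bound for $D_z$, below which all values of $D_z$ are removed, such that the constraint on the reduced domains has the same tuples as before and is hyper-arc consistent. -/

import Mathlib

namespace SoftAllDiff

/-! ### Constraints -/

/-- A constraint `C` on variables indexed by `ι` with finite domains `D` is hyper-arc consistent if
every value of every domain occurs in a tuple of `C` whose entries all lie in the domains. -/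
def HyperArcConsistent {ι : Type} (D : ι → Finset ℤ) (C : Set (ι → ℤ)) : Prop :=
  ∀ i, ∀ d ∈ D i, ∃ τ ∈ C, τ i = d ∧ ∀ j, τ j ∈ D j

/-- The number of pairs `i < j` with `x i = x j`. -/
def violation {n : ℕ} (x : Fin n → ℤ) : ℕ :=
  (Finset.univ.filter (fun p : Fin n × Fin n => p.1 < p.2 ∧ x p.1 = x p.2)).card

/-- The domains of the `n + 1` variables `x 0, …, x (n - 1), z`: the index `some i` stands for
the variable `x i`, the index `none` for the cost variable `z`. -/
def softDomains {n : ℕ} (D : Fin n → Finset ℤ) (Dz : Finset ℤ) : Option (Fin n) → Finset ℤ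
  | some i => D i
  | none => Dz

/-- The soft alldifferent constraint on `x 0, …, x (n - 1), z`, as a set of tuples. -/
def softAllDiff {n : ℕ} (D : Fin n → Finset ℤ) (Dz : Finset ℤ) : Set (Option (Fin n) → ℤ) :=
  {τ | (∀ j, τ j ∈ softDomains D Dz j) ∧
    (violation (fun i => τ (some i)) : ℤ) ≤ τ none}

/-- The sum of the cardinalities of the domains of `x 0, …, x (n - 1)`. -/
def size {n : ℕ} (D : Fin n → Finset ℤ) : ℕ := ∑ i, (D i).card

/-! ### Flows -/

/-- A directed multigraph with vertices `V` and arcs `A`, a source `s` and a sink `t`, capacities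
and costs. -/
structure Network (V A : Type) where
  tail : A → V
  head : A → V
  s : V
  t : V
  cap : A → ℝ
  w : A → ℝ

namespace Network

variable {V A : Type} [DecidableEq V] [Fintype A] (N : Network V A)

/-- The amount of flow leaving `v`. -/
def outflow (f : A → ℝ) (v : V) : ℝ := ∑ a with N.tail a = v, f a

/-- The amount of flow entering `v`. -/
def inflow (f : A → ℝ) (v : V) : ℝ := ∑ a with N.head a = v, f a

/-- `f` is a flow from `s` to `t` that respects the capacities. -/
structure IsFeasibleFlow (f : A → ℝ) : Prop where
  nonneg : ∀ a, 0 ≤ f a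
  le_cap : ∀ a, f a ≤ N.cap a
  conservation : ∀ v, v ≠ N.s → v ≠ N.t → N.outflow f v = N.inflow f v

/-- The net amount of flow leaving the source. -/
def value (f : A → ℝ) : ℝ := N.outflow f N.s - N.inflow f N.s

/-- The cost of a flow. -/
def cost (f : A → ℝ) : ℝ := ∑ a, N.w a * f a

/-- `f` is a feasible flow of maximum value and, among those, of minimum cost. -/
structure IsMinCostFlow (f : A → ℝ) : Prop where
  feasible : N.IsFeasibleFlow f
  max_value : ∀ g, N.IsFeasibleFlow g → N.value g ≤ N.value f
  min_cost : ∀ g, N.IsFeasibleFlow g → N.value g = N.value f → N.cost f ≤ N.cost g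

end Network

/-! ### The network of the soft alldifferent constraint -/

section Graph

variable {n : ℕ} (D : Fin n → Finset ℤ)

/-- The union of the domains. -/
def valueSet : Finset ℤ := Finset.univ.biUnion D

/-- The number of variables whose domain contains `d`. -/
def mult (d : ℤ) : ℕ := (Finset.univ.filter (fun i => d ∈ D i)).card

/-- The vertices: source, sink, one vertex per variable and one per domain value. -/
inductive Vertex : Type
  | source : Vertex
  | sink : Vertex
  | var (i : Fin n) : Vertex
  | val (d : {d // d ∈ valueSet D}) : Vertex
  deriving DecidableEq

/-- The arcs `(x i, d)` with `d` in the domain of `x i`. -/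
abbrev VarArc : Type := Σ i : Fin n, {d // d ∈ D i}

/-- All arcs: the arcs `(s, x i)`, the arcs `(x i, d)`, and for each value `d` the parallel arcs
`(d, t)_0, …, (d, t)_{k-1}`, where `k` is the number of variables with `d` in their domain. -/
abbrev Arc : Type := Fin n ⊕ VarArc D ⊕ (Σ d : {d // d ∈ valueSet D}, Fin (mult D d))

/-- The arc `(x i, d)` as an arc of the network. -/
abbrev varArc (a : VarArc D) : Arc D := Sum.inr (Sum.inl a)

/-- The network: all capacities are `1`, the arc `(d, t)_k` costs `k`, all other arcs cost `0`. -/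
def network : Network (Vertex D) (Arc D) where
  tail
    | .inl _ => .source
    | .inr (.inl a) => .var a.1
    | .inr (.inr b) => .val b.1
  head
    | .inl i => .var i
    | .inr (.inl a) => .val ⟨a.2.1, Finset.mem_biUnion.2 ⟨a.1, Finset.mem_univ _, a.2.2⟩⟩
    | .inr (.inr _) => .sink
  s := .source
  t := .sink
  cap _ := 1
  w
    | .inl _ => 0
    | .inr (.inl _) => 0
    | .inr (.inr b) => (b.2 : ℕ)

end Graph

/-! ### The machine model

A random access machine with integer words, unit cost per operation, the arithmetic operations
`+` and `-` only, and structured control flow. The memory consists of registers and of arrays.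
A program is a finite text, so it names finitely many registers and arrays; array cells are
addressed by computed indices. -/

/-- The memory of the machine. -/
structure State where
  reg : ℕ → ℤ
  arr : ℕ → ℤ → ℤ

/-- Expressions: constants, registers, array cells, sums and differences. -/
inductive Expr : Type
  | const (z : ℤ) : Expr
  | reg (r : ℕ) : Expr
  | arr (a : ℕ) (i : Expr) : Expr
  | add (e₁ e₂ : Expr) : Expr
  | sub (e₁ e₂ : Expr) : Expr

/-- The value of an expression. -/
def Expr.eval (σ : State) : Expr → ℤ
  | .const z => z
  | .reg r => σ.reg r
  | .arr a i => σ.arr a (i.eval σ)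
  | .add e₁ e₂ => e₁.eval σ + e₂.eval σ
  | .sub e₁ e₂ => e₁.eval σ - e₂.eval σ

/-- The time to evaluate an expression: one step per operation or memory access. -/
def Expr.time : Expr → ℕ
  | .const _ => 1
  | .reg _ => 1
  | .arr _ i => i.time + 1
  | .add e₁ e₂ => e₁.time + e₂.time + 1
  | .sub e₁ e₂ => e₁.time + e₂.time + 1

/-- Programs. A test is a comparison `e₁ < e₂`. -/
inductive Program : Type
  | skip : Program
  | assign (r : ℕ) (e : Expr) : Program
  | store (a : ℕ) (i e : Expr) : Program
  | seq (p q : Program) : Program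
  | ifLt (e₁ e₂ : Expr) (p q : Program) : Program
  | whileLt (e₁ e₂ : Expr) (p : Program) : Program

/-- `Exec p σ T σ'`: started in the memory `σ`, the program `p` halts after exactly `T` steps in
the memory `σ'`. -/
inductive Exec : Program → State → ℕ → State → Prop
  | skip (σ : State) : Exec .skip σ 1 σ
  | assign (r : ℕ) (e : Expr) (σ : State) :
      Exec (.assign r e) σ (e.time + 1)
        { reg := Function.update σ.reg r (e.eval σ), arr := σ.arr }
  | store (a : ℕ) (i e : Expr) (σ : State) :
      Exec (.store a i e) σ (i.time + e.time + 1)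
        { reg := σ.reg
          arr := Function.update σ.arr a (Function.update (σ.arr a) (i.eval σ) (e.eval σ)) }
  | seq {p q : Program} {σ₁ σ₂ σ₃ : State} {T₁ T₂ : ℕ} :
      Exec p σ₁ T₁ σ₂ → Exec q σ₂ T₂ σ₃ → Exec (.seq p q) σ₁ (T₁ + T₂) σ₃
  | ifTrue {e₁ e₂ : Expr} {p q : Program} {σ σ' : State} {T : ℕ} :
      e₁.eval σ < e₂.eval σ → Exec p σ T σ' →
      Exec (.ifLt e₁ e₂ p q) σ (e₁.time + e₂.time + 1 + T) σ'
  | ifFalse {e₁ e₂ : Expr} {p q : Program} {σ σ' : State} {T : ℕ} :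
      ¬ e₁.eval σ < e₂.eval σ → Exec q σ T σ' →
      Exec (.ifLt e₁ e₂ p q) σ (e₁.time + e₂.time + 1 + T) σ'
  | whileTrue {e₁ e₂ : Expr} {p : Program} {σ₁ σ₂ σ₃ : State} {T₁ T₂ : ℕ} :
      e₁.eval σ₁ < e₂.eval σ₁ → Exec p σ₁ T₁ σ₂ → Exec (.whileLt e₁ e₂ p) σ₂ T₂ σ₃ →
      Exec (.whileLt e₁ e₂ p) σ₁ (e₁.time + e₂.time + 1 + T₁ + T₂) σ₃
  | whileFalse {e₁ e₂ : Expr} {p : Program} {σ : State} :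
      ¬ e₁.eval σ < e₂.eval σ → Exec (.whileLt e₁ e₂ p) σ (e₁.time + e₂.time + 1) σ

/-! ### Input and output -/

section Encoding

variable {n : ℕ} (D : Fin n → Finset ℤ)

/-- The initial memory. With `m = size D`, the domains are given as the list of the `m` pairs
`(x i, d)` with `d` in the domain of `x i`, in the order `enum`: for `p < m`, the arrays `0`, `1`,
`2` hold at position `p` the index `i`, the value `d` and the flow on the arc `(x i, d)` of the
`p`-th pair. (The flow on the other arcs is not handed to the program.) The registers
`0`, `1`, `2`, `3` hold `n`, `m`, and the least and the greatest value of the domain of `z`.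
Everything else is `0`. -/
def inputState (zmin zmax : ℤ) (f : Arc D → ℤ) (enum : Fin (size D) ≃ VarArc D) : State where
  reg r := match r with
    | 0 => n
    | 1 => size D
    | 2 => zmin
    | 3 => zmax
    | _ => 0
  arr a p :=
    if h : 0 ≤ p ∧ p.toNat < size D then
      match a with
      | 0 => ((enum ⟨p.toNat, h.2⟩).1 : ℕ)
      | 1 => (enum ⟨p.toNat, h.2⟩).2.1
      | 2 => f (varArc D (enum ⟨p.toNat, h.2⟩))
      | _ => 0
    else 0

/-- The domains of `x 0, …, x (n - 1)` read off from the final memory: the value of the `p`-th pair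
stays in the domain of its variable exactly if array `3` holds `1` at position `p`. -/
def outputDomains (enum : Fin (size D) ≃ VarArc D) (σ : State) (i : Fin n) : Finset ℤ :=
  ((D i).attach.filter (fun d => σ.arr 3 ((enum.symm ⟨i, d⟩ : ℕ) : ℤ) = 1)).map
    (Function.Embedding.subtype _)

/-- The domain of `z` read off from the final memory: the values that are not below the new lower
bound in register `4`. -/
def outputCostDomain (Dz : Finset ℤ) (σ : State) : Finset ℤ :=
  Dz.filter (fun z => σ.reg 4 ≤ z)

end Encoding

end SoftAllDiff

open SoftAllDiff

namespace SoftAllDiff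

open Relation

/-! ### Shifts between values and optimal assignments -/

section Assignments

variable {n : ℕ}

/-! An integral minimum-cost flow is an assignment `a` of least violation
(`exists_isOptimal_of_isMinCostFlow`): the costs `0, 1, 2, …` of the parallel arcs add up to the
number of conflicting pairs. The violation is a separable convex function of the counts of the
values (`two_mul_violation`). Make the values a directed graph with an arc `u → w` whenever a
variable assigned to `u` may take `w`. Shifting variables along a shortest path from `u` to `w ≠ u`
(`exists_shift`) changes the violation by `count a w - count a u + 1`. Optimality therefore forbids
a path that lowers the count by more than one (`IsOptimal.count_le`), so `low` and `high`, the
extreme counts after and before a value, are each within one of its own count.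

If `d` reaches `a i`, rotating along a cycle gives an optimal assignment with `x i = d`
(`exists_of_reach`). Otherwise the least violation with `x i = d` is exactly `violation a + low D a
d - high D a (a i) + 1`. Two disjoint shifts attain it (`exists_of_not_reach`), and a dual argument
with slopes of the convex cost shows that nothing is cheaper (`le_violation_of_not_reach`).
Comparing with the greatest value of `z` decides which pairs stay (`exists_violation_le_iff`); the
new lower bound for `z` is `violation a`.

All of this is computed by four graph searches. The pair `(i, d)` is itself an arc `a i → d`, so `d`
reaches `a i` exactly if both lie in one strongly connected component, and Kosaraju's two searches
find these (`SearchResult.lab_eq_iff`). The corrections in `low` and `high` need one search each,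
along arcs between equal counts (`exists_reach_count_lt_iff`, `exists_reach_count_gt_iff`). Each
search is linear in `m`: arrays are addressed directly by values and start at zero, so no sorting or
initialisation is needed. -/

/-- The number of variables that take the value `v`. -/
def count (x : Fin n → ℤ) (v : ℤ) : ℤ := ∑ i, if x i = v then 1 else 0

theorem count_nonneg (x : Fin n → ℤ) (v : ℤ) : 0 ≤ count x v :=
  Finset.sum_nonneg fun i _ => by split_ifs <;> norm_num

theorem sum_count_mul (x : Fin n → ℤ) {S : Finset ℤ} (hS : ∀ i, x i ∈ S) (g : ℤ → ℤ) :
    ∑ v ∈ S, count x v * g v = ∑ i, g (x i) := by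
  simp only [count, Finset.sum_mul]
  rw [Finset.sum_comm]
  refine Finset.sum_congr rfl fun i _ => ?_
  simp [hS i]

/-- A value taken by `c` variables accounts for `c * (c - 1)` ordered pairs in conflict. This makes
the violation depend on the counts alone, through a convex function of each. -/
theorem two_mul_violation (x : Fin n → ℤ) {S : Finset ℤ} (hS : ∀ i, x i ∈ S) :
    2 * (violation x : ℤ) = ∑ v ∈ S, count x v * (count x v - 1) := by
  rw [sum_count_mul x hS fun v => count x v - 1]
  have h1 : (violation x : ℤ) = ∑ i, ∑ j, if i < j ∧ x i = x j then 1 else 0 := by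
    rw [violation, Finset.card_filter, Fintype.sum_prod_type]
    push_cast
    rfl
  have h2 : (violation x : ℤ) = ∑ i, ∑ j, if j < i ∧ x j = x i then 1 else 0 := by
    rw [h1, Finset.sum_comm]
  rw [two_mul]
  nth_rw 1 [h1]
  rw [h2, ← Finset.sum_add_distrib]
  refine Finset.sum_congr rfl fun i _ => ?_
  -- The `- 1` becomes the diagonal term, so the identity can be checked separately for each ordered
  -- pair `(i, j)`.
  have h3 : (1 : ℤ) = ∑ j, if j = i then 1 else 0 := by simp
  rw [h3, count, ← Finset.sum_add_distrib, ← Finset.sum_sub_distrib]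
  refine Finset.sum_congr rfl fun j _ => ?_
  rcases lt_trichotomy i j with h | h | h
  · by_cases hx : x i = x j
    · simp [h, hx, h.ne', h.not_gt]
    · simp [hx, Ne.symm hx, h.ne']
  · simp [h]
  · by_cases hx : x i = x j
    · simp [h, hx, h.ne, h.not_gt]
    · simp [hx, Ne.symm hx, h.ne]

variable (D : Fin n → Finset ℤ) (a : Fin n → ℤ)

/-- Some variable with value `u` can be given the value `w`. -/
def Move (u w : ℤ) : Prop := ∃ i, a i = u ∧ w ∈ D i

/-- A sequence of moves leads from `u` to `w`. -/
abbrev Reach : ℤ → ℤ → Prop := ReflTransGen (Move D a)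

/-- `w` can be reached from `u` in exactly `k` moves. -/
def StepReach (w : ℤ) : ℕ → ℤ → Prop
  | 0, u => u = w
  | k + 1, u => ∃ u', Move D a u u' ∧ StepReach w k u'

variable {D a}

theorem StepReach.reach {w : ℤ} : ∀ {k : ℕ} {u : ℤ}, StepReach D a w k u → Reach D a u w
  | 0, _, h => by rw [StepReach] at h; rw [h]
  | _ + 1, _, ⟨_, h, h'⟩ => .head h h'.reach

theorem exists_stepReach {u w : ℤ} (h : Reach D a u w) : ∃ k, StepReach D a w k u := by
  induction h using ReflTransGen.head_induction_on with
  | refl => exact ⟨0, rfl⟩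
  | head h _ ih => exact ⟨ih.choose + 1, _, h, ih.choose_spec⟩

theorem count_update (x : Fin n → ℤ) (i : Fin n) (d v : ℤ) :
    count (Function.update x i d) v =
      count x v + (if d = v then 1 else 0) - if x i = v then 1 else 0 := by
  have h (y : Fin n → ℤ) : count y v = (if y i = v then 1 else 0) +
      ∑ j ∈ Finset.univ.erase i, if y j = v then 1 else 0 :=
    (Finset.add_sum_erase _ _ (Finset.mem_univ i)).symm
  rw [h (Function.update x i d), h x, Finset.sum_congr rfl
    (g := fun j => if x j = v then (1 : ℤ) else 0)]
  · simp only [Function.update_self]; ring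
  · intro j hj
    rw [Function.update_of_ne (Finset.ne_of_mem_erase hj)]

/-- One variable is moved per step of the path, from the far end backwards. Since the path is
shortest, its values are distinct and no variable is moved twice. The last clause locates the
variables that change, so that two shifts can later be shown not to interfere. -/
theorem exists_shift_of_stepReach (ha : ∀ i, a i ∈ D i) {w : ℤ} : ∀ {k : ℕ} {u : ℤ},
    StepReach D a w k u → (∀ l < k, ¬ StepReach D a w l u) →
    ∃ τ : Fin n → ℤ, (∀ i, τ i ∈ D i) ∧
      (∀ v, count τ v = count a v + (if w = v then 1 else 0) - if u = v then 1 else 0) ∧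
      ∀ j, τ j ≠ a j → Reach D a u (a j) ∧ (∃ l ≤ k, StepReach D a w l (a j)) ∧ a j ≠ w
  | 0, u, h, _ => by
    rw [StepReach] at h
    exact ⟨a, ha, fun v => by simp [h], fun j hj => absurd rfl hj⟩
  | k + 1, u, ⟨u', ⟨i, hi, hu'⟩, h⟩, hk => by
    obtain ⟨τ, hτ, hc, hd⟩ := exists_shift_of_stepReach ha h
      fun l hl h' => hk (l + 1) (by omega) ⟨u', ⟨i, hi, hu'⟩, h'⟩
    -- Otherwise the rest of the path has already moved `i`, and its value `u` would be within `k`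
    -- steps of `w`.
    have hτi : τ i = u := by
      by_contra hne
      obtain ⟨_, ⟨l, hl, hl'⟩, _⟩ := hd i (by rwa [hi])
      exact hk l (by omega) (hi ▸ hl')
    refine ⟨Function.update τ i u', fun j => ?_, fun v => ?_, fun j hj => ?_⟩
    · rcases eq_or_ne j i with rfl | hj
      · simpa
      · simpa [hj] using hτ j
    · rw [count_update, hc, hτi]; ring
    · rcases eq_or_ne j i with rfl | hji
      · refine ⟨by rw [hi], ⟨k + 1, le_rfl, ?_⟩, ?_⟩
        · rw [hi]; exact ⟨u', ⟨j, hi, hu'⟩, h⟩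
        · rw [hi]; exact fun h0 => hk 0 (by omega) h0
      · rw [Function.update_of_ne hji] at hj
        obtain ⟨h1, ⟨l, hl, hl'⟩, h2⟩ := hd j hj
        exact ⟨.head ⟨i, hi, hu'⟩ h1, ⟨l, by omega, hl'⟩, h2⟩

/-- Shifting along a shortest path moves one variable from `u` to `w`. -/
theorem exists_shift (ha : ∀ i, a i ∈ D i) {u w : ℤ} (h : Reach D a u w) :
    ∃ τ : Fin n → ℤ, (∀ i, τ i ∈ D i) ∧
      (∀ v, count τ v = count a v + (if w = v then 1 else 0) - if u = v then 1 else 0) ∧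
      ∀ j, τ j ≠ a j → Reach D a u (a j) ∧ Reach D a (a j) w ∧ a j ≠ w := by
  classical
  have hex := exists_stepReach h
  obtain ⟨τ, h1, h2, h3⟩ := exists_shift_of_stepReach ha (Nat.find_spec hex)
    fun l hl => Nat.find_min hex hl
  refine ⟨τ, h1, h2, fun j hj => ?_⟩
  obtain ⟨h4, ⟨l, _, h5⟩, h6⟩ := h3 j hj
  exact ⟨h4, h5.reach, h6⟩

/-- A variable that arrives at `w` creates `count a w` conflicts, and one that leaves `u` removes
`count a u - 1`. -/
theorem violation_of_shift {τ : Fin n → ℤ} {u w : ℤ} (huw : u ≠ w)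
    (h : ∀ v, count τ v = count a v + (if w = v then 1 else 0) - if u = v then 1 else 0) :
    (violation τ : ℤ) = violation a + count a w - count a u + 1 := by
  set S : Finset ℤ := Finset.univ.image τ ∪ Finset.univ.image a ∪ {u, w} with hS
  have hτ := two_mul_violation τ (S := S) fun i => by simp [hS]
  have ha := two_mul_violation a (S := S) fun i => by simp [hS]
  have key : ∑ v ∈ S, count τ v * (count τ v - 1) = ∑ v ∈ S, (count a v * (count a v - 1) +
      (if w = v then 2 * count a v else 0) - if u = v then 2 * count a v - 2 else 0) := by
    refine Finset.sum_congr rfl fun v _ => ?_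
    rw [h]
    split_ifs with h1 h2
    · exact absurd (h2.trans h1.symm) huw
    all_goals ring
  rw [Finset.sum_sub_distrib, Finset.sum_add_distrib, Finset.sum_ite_eq, Finset.sum_ite_eq,
    if_pos (by simp [hS]), if_pos (by simp [hS])] at key
  linarith

theorem violation_congr {τ : Fin n → ℤ} (h : ∀ v, count τ v = count a v) :
    violation τ = violation a := by
  set S : Finset ℤ := Finset.univ.image τ ∪ Finset.univ.image a with hS
  have hτ := two_mul_violation τ (S := S) fun i => by simp [hS]
  have ha := two_mul_violation a (S := S) fun i => by simp [hS]
  simp only [h] at hτ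
  omega

/-- For `u = w` nothing changes and the bound has slack one; the inequality spares a case
distinction in its applications. -/
theorem violation_le_of_shift {τ : Fin n → ℤ} {u w : ℤ}
    (h : ∀ v, count τ v = count a v + (if w = v then 1 else 0) - if u = v then 1 else 0) :
    (violation τ : ℤ) ≤ violation a + count a w - count a u + 1 := by
  rcases eq_or_ne u w with rfl | huw
  · have := violation_congr (τ := τ) (a := a) fun v => by rw [h v]; ring
    omega
  · exact (violation_of_shift huw h).le

/-- `a` is an assignment of least violation. -/
structure IsOptimal (D : Fin n → Finset ℤ) (a : Fin n → ℤ) : Prop where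
  mem : ∀ i, a i ∈ D i
  le : ∀ τ : Fin n → ℤ, (∀ i, τ i ∈ D i) → violation a ≤ violation τ

/-- If the count dropped by two or more, the shift from `u` to `w` would lower the violation. This
is the absence of negative cycles in the residual graph. -/
theorem IsOptimal.count_le (h : IsOptimal D a) {u w : ℤ} (hr : Reach D a u w) :
    count a u ≤ count a w + 1 := by
  obtain ⟨τ, h1, h2, -⟩ := exists_shift h.mem hr
  have h3 := violation_le_of_shift h2
  have h4 := h.le τ h1
  omega

variable (D a)

open Classical in
/-- The least count of a value that can be reached from `v`, for an optimal assignment. -/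
noncomputable def low (v : ℤ) : ℤ :=
  count a v - if ∃ b, Reach D a v b ∧ count a b < count a v then 1 else 0

open Classical in
/-- The greatest count of a value from which `v` can be reached, for an optimal assignment. -/
noncomputable def high (v : ℤ) : ℤ :=
  count a v + if ∃ b, Reach D a b v ∧ count a v < count a b then 1 else 0

variable {D a}

/-- Counts reachable from `v` are at least `count a v - 1` by `IsOptimal.count_le`, so a yes-or-no
question determines their minimum. Together with `exists_count_eq_low` this identifies `low` as that
minimum. -/
theorem low_le_count (h : IsOptimal D a) {v b : ℤ} (hr : Reach D a v b) :
    low D a v ≤ count a b := by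
  rw [low]
  split_ifs with hb
  · have := h.count_le hr; omega
  · by_contra hlt
    exact hb ⟨b, hr, by omega⟩

theorem count_le_high (h : IsOptimal D a) {v b : ℤ} (hr : Reach D a b v) :
    count a b ≤ high D a v := by
  rw [high]
  split_ifs with hb
  · exact h.count_le hr
  · by_contra hlt
    exact hb ⟨b, hr, by omega⟩

theorem exists_count_eq_low (h : IsOptimal D a) (v : ℤ) :
    ∃ b, Reach D a v b ∧ count a b = low D a v := by
  by_cases hb : ∃ b, Reach D a v b ∧ count a b < count a v
  · obtain ⟨b, hr, hlt⟩ := hb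
    refine ⟨b, hr, ?_⟩
    have := h.count_le hr
    rw [low, if_pos ⟨b, hr, hlt⟩]
    omega
  · exact ⟨v, .refl, by rw [low, if_neg hb, sub_zero]⟩

theorem exists_count_eq_high (h : IsOptimal D a) (v : ℤ) :
    ∃ b, Reach D a b v ∧ count a b = high D a v := by
  by_cases hb : ∃ b, Reach D a b v ∧ count a v < count a b
  · obtain ⟨b, hr, hlt⟩ := hb
    refine ⟨b, hr, ?_⟩
    have := h.count_le hr
    rw [high, if_pos ⟨b, hr, hlt⟩]
    omega
  · exact ⟨v, .refl, by rw [high, if_neg hb, add_zero]⟩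

/-- The function `c * (c - 1) / 2` on the integers lies above its lines of slope `c₀ - 1` and `c₀`
through the point at `c₀`. Summing these tangent bounds over the values turns the slopes into prices
paid by the variables. -/
theorem le_violation_of_slope {S : Finset ℤ} {τ : Fin n → ℤ} {s : ℤ → ℤ}
    (hτ : ∀ i, τ i ∈ S) (ha : ∀ i, a i ∈ S)
    (hs : ∀ v : ℤ, count a v - 1 ≤ s v ∧ s v ≤ count a v) :
    (violation a : ℤ) + ∑ i, (s (τ i) - s (a i)) ≤ violation τ := by
  have h1 := two_mul_violation τ hτ
  have h2 := two_mul_violation a ha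
  have key : ∀ v ∈ S, 2 * (count τ v * s v - count a v * s v) ≤
      count τ v * (count τ v - 1) - count a v * (count a v - 1) := by
    intro v _
    obtain ⟨h3, h4⟩ := hs v
    have h5 : s v = count a v - 1 ∨ s v = count a v := by omega
    -- A product of two consecutive integers is nonnegative; `h6` serves the slope `count a v - 1`
    -- and `h7` the slope `count a v`.
    have h6 : 0 ≤ (count τ v - count a v) * (count τ v - count a v + 1) := by
      rcases le_or_gt 0 (count τ v - count a v) with h | h
      · positivity
      · exact mul_nonneg_of_nonpos_of_nonpos h.le (by omega)
    have h7 : 0 ≤ (count τ v - count a v) * (count τ v - count a v - 1) := by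
      rcases le_or_gt (count τ v - count a v) 0 with h | h
      · exact mul_nonneg_of_nonpos_of_nonpos h (by omega)
      · exact mul_nonneg h.le (by omega)
    rcases h5 with h5 | h5 <;> rw [h5] <;> linarith
  have h3 := Finset.sum_le_sum key
  rw [← Finset.mul_sum, Finset.sum_sub_distrib, Finset.sum_sub_distrib, ← h1, ← h2,
    sum_count_mul τ hτ, sum_count_mul a ha] at h3
  rw [Finset.sum_sub_distrib]
  linarith

/-- A duality argument: the slopes act as a dual solution adapted to the cut between the values
reachable from `τ i` and the others. -/
theorem le_violation_of_not_reach (h : IsOptimal D a) {τ : Fin n → ℤ} (hτ : ∀ i, τ i ∈ D i)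
    (i : Fin n) (hr : ¬ Reach D a (τ i) (a i)) :
    (violation a : ℤ) + low D a (τ i) - high D a (a i) + 1 ≤ violation τ := by
  classical
  -- Both choices are admissible slopes, and `s` never decreases along a move. The move from `a i`
  -- to `τ i` enters the reachable set, and its increase of `s` is the extra cost claimed.
  set s : ℤ → ℤ := fun v => if Reach D a (τ i) v then low D a v else high D a v - 1 with hs
  have hS : ∀ v, count a v - 1 ≤ s v ∧ s v ≤ count a v := by
    intro v
    simp only [hs, low, high]
    split_ifs <;> constructor <;> omega
  have key := le_violation_of_slope (S := Finset.univ.image τ ∪ Finset.univ.image a)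
    (τ := τ) (a := a) (s := s) (by simp) (by simp) hS
  -- Every change from `a j` to `τ j` is a move, so all terms of the slope bound are nonnegative and
  -- those with `j ≠ i` can be dropped.
  have hmono : ∀ j, 0 ≤ s (τ j) - s (a j) := by
    intro j
    have hm : Move D a (a j) (τ j) := ⟨j, rfl, hτ j⟩
    simp only [hs]
    by_cases h1 : Reach D a (τ i) (a j)
    · rw [if_pos h1, if_pos (h1.tail hm)]
      obtain ⟨b, hb, hb'⟩ := exists_count_eq_low h (τ j)
      have := low_le_count h (ReflTransGen.head hm hb)
      omega
    · rw [if_neg h1]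
      obtain ⟨b, hb, hb'⟩ := exists_count_eq_high h (a j)
      split_ifs with h2
      · obtain ⟨b', hb1, hb2⟩ := exists_count_eq_low h (τ j)
        -- A move that crosses the cut joins a value of greatest count before `a j` to one of least
        -- count after `τ j`; optimality bounds the drop by one, which is the `- 1` in `s`.
        have := h.count_le ((hb.tail hm).trans hb1)
        omega
      · have := count_le_high h (hb.tail hm)
        omega
  have hle := Finset.single_le_sum (fun j _ => hmono j) (Finset.mem_univ i)
  have h1 : s (τ i) = low D a (τ i) := if_pos .refl
  have h2 : s (a i) = high D a (a i) - 1 := if_neg hr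
  rw [h1, h2] at hle
  linarith

/-- Moving `i` from `a i` to `d` closes the path from `d` to `a i` into a cycle, and a rotation
along a cycle preserves all counts. The shift leaves variables at its end value alone, so `i` is
still free. -/
theorem exists_of_reach (h : IsOptimal D a) {i : Fin n} {d : ℤ} (hd : d ∈ D i)
    (hr : Reach D a d (a i)) :
    ∃ τ : Fin n → ℤ, (∀ j, τ j ∈ D j) ∧ τ i = d ∧ violation τ = violation a := by
  obtain ⟨τ, h1, h2, h3⟩ := exists_shift h.mem hr
  have hi : τ i = a i := by
    by_contra hne
    exact (h3 i hne).2.2 rfl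
  refine ⟨Function.update τ i d, fun j => ?_, by simp, violation_congr fun v => ?_⟩
  · rcases eq_or_ne j i with rfl | hj
    · simpa
    · simpa [hj] using h1 j
  · rw [count_update, h2, hi]; ring

/-- One shift leads from `d` to a value of least count, another from a value of greatest count to `a
i`, and `i` moves from `a i` to `d`. A variable changed by both shifts would link `d` to `a i`, so
the shifts can be superposed; the total effect is one shift from the greatest count to the least. -/
theorem exists_of_not_reach (h : IsOptimal D a) {i : Fin n} {d : ℤ} (hd : d ∈ D i)
    (hr : ¬ Reach D a d (a i)) :
    ∃ τ : Fin n → ℤ, (∀ j, τ j ∈ D j) ∧ τ i = d ∧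
      (violation τ : ℤ) ≤ violation a + low D a d - high D a (a i) + 1 := by
  classical
  obtain ⟨b, hb, hb'⟩ := exists_count_eq_low h d
  obtain ⟨b', hc, hc'⟩ := exists_count_eq_high h (a i)
  obtain ⟨τ₁, h11, h12, h13⟩ := exists_shift h.mem hb
  obtain ⟨τ₂, h21, h22, h23⟩ := exists_shift h.mem hc
  have hi1 : τ₁ i = a i := by
    by_contra hne
    exact hr (h13 i hne).1
  have hi2 : τ₂ i = a i := by
    by_contra hne
    exact (h23 i hne).2.2 rfl
  have hdisj : ∀ j, τ₁ j = a j ∨ τ₂ j = a j := by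
    intro j
    by_contra! hne
    exact hr ((h13 j hne.1).1.trans (h23 j hne.2).2.1)
  set τ₃ : Fin n → ℤ := fun j => if τ₁ j = a j then τ₂ j else τ₁ j with h3
  have hi3 : τ₃ i = a i := by simp [h3, hi1, hi2]
  have hcount : ∀ v, count τ₃ v + count a v = count τ₁ v + count τ₂ v := by
    intro v
    simp only [count, ← Finset.sum_add_distrib]
    refine Finset.sum_congr rfl fun j _ => ?_
    simp only [h3]
    rcases hdisj j with hj | hj
    · simp only [hj, if_true]; ring
    · by_cases hj' : τ₁ j = a j
      · simp only [hj', if_true]; ring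
      · rw [if_neg hj', hj]
  refine ⟨Function.update τ₃ i d, fun j => ?_, by simp, ?_⟩
  · rcases eq_or_ne j i with rfl | hj
    · simpa
    · simp only [ne_eq, hj, not_false_eq_true, Function.update_of_ne, h3]
      split_ifs
      exacts [h21 j, h11 j]
  · rw [← hb', ← hc']
    refine violation_le_of_shift fun v => ?_
    have := hcount v
    rw [count_update, hi3]
    rw [h12, h22] at this
    linarith

/-- The values that occur in an assignment of violation at most `B`. -/
theorem exists_violation_le_iff (h : IsOptimal D a) {i : Fin n} {d B : ℤ} (hd : d ∈ D i)
    (hB : violation a ≤ B) :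
    (∃ τ : Fin n → ℤ, (∀ j, τ j ∈ D j) ∧ τ i = d ∧ (violation τ : ℤ) ≤ B) ↔
      Reach D a d (a i) ∨ (violation a : ℤ) + low D a d - high D a (a i) + 1 ≤ B := by
  constructor
  · rintro ⟨τ, hτ, rfl, hv⟩
    by_cases hr : Reach D a (τ i) (a i)
    · exact .inl hr
    · exact .inr ((le_violation_of_not_reach h hτ i hr).trans hv)
  · intro h'
    by_cases hr : Reach D a d (a i)
    · obtain ⟨τ, h1, h2, h3⟩ := exists_of_reach h hd hr
      exact ⟨τ, h1, h2, by rwa [h3]⟩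
    · obtain ⟨τ, h1, h2, h3⟩ := exists_of_not_reach h hd hr
      exact ⟨τ, h1, h2, h3.trans (h'.resolve_left hr)⟩

/-- A value reaches a smaller count if and only if it reaches, by moves between values of equal
counts, a value with a move to a smaller count. -/
theorem exists_reach_count_lt_iff (h : IsOptimal D a) {M : ℤ → ℤ → Prop}
    (hM : ∀ {u w}, M u w → ReflGen (Move D a) u w ∧ count a u = count a w)
    (hM' : ∀ {u w}, Move D a u w → count a u = count a w → M u w) (v : ℤ) :
    (∃ b, Reach D a v b ∧ count a b < count a v) ↔
      ∃ u w, ReflTransGen M v u ∧ Move D a u w ∧ count a w < count a u := by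
  constructor
  · rintro ⟨b, hr, hlt⟩
    induction hr using ReflTransGen.head_induction_on with
    | refl => exact absurd hlt (lt_irrefl _)
    | @head u w hm hr ih =>
      -- The count cannot rise at `w`: as `w` still reaches `b`, it would exceed the count of `b` by
      -- two. So the first change of count along the path is the required drop.
      rcases lt_trichotomy (count a w) (count a u) with h1 | h1 | h1
      · exact ⟨u, w, .refl, hm, h1⟩
      · obtain ⟨x, y, h2, h3, h4⟩ := ih (h1 ▸ hlt)
        exact ⟨x, y, .head (hM' hm h1.symm) h2, h3, h4⟩
      · have := h.count_le hr
        omega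
  · rintro ⟨u, w, hr, hm, hlt⟩
    have : Reach D a v u ∧ count a v = count a u := by
      clear hlt hm
      induction hr with
      | refl => exact ⟨.refl, rfl⟩
      | tail _ hm ih => exact ⟨ih.1.trans (hM hm).1.to_reflTransGen, ih.2.trans (hM hm).2⟩
    exact ⟨w, this.1.tail hm, by omega⟩

/-- A value is reached from a greater count if and only if it is reached, by moves between values
of equal counts, from a value with a move from a greater count. -/
theorem exists_reach_count_gt_iff (h : IsOptimal D a) {M : ℤ → ℤ → Prop}
    (hM : ∀ {u w}, M u w → ReflGen (Move D a) u w ∧ count a u = count a w)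
    (hM' : ∀ {u w}, Move D a u w → count a u = count a w → M u w) (v : ℤ) :
    (∃ b, Reach D a b v ∧ count a v < count a b) ↔
      ∃ u w, ReflTransGen M w v ∧ Move D a u w ∧ count a w < count a u := by
  constructor
  · rintro ⟨b, hr, hlt⟩
    induction hr with
    | refl => exact absurd hlt (lt_irrefl _)
    | @tail u w hr hm ih =>
      rcases lt_trichotomy (count a w) (count a u) with h1 | h1 | h1
      · exact ⟨u, w, .refl, hm, h1⟩
      · obtain ⟨x, y, h2, h3, h4⟩ := ih (h1 ▸ hlt)
        exact ⟨x, y, h2.tail (hM' hm h1.symm), h3, h4⟩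
      · have := h.count_le hr
        omega
  · rintro ⟨u, w, hr, hm, hlt⟩
    have : Reach D a w v ∧ count a w = count a v := by
      clear hlt hm
      induction hr with
      | refl => exact ⟨.refl, rfl⟩
      | tail _ hm ih => exact ⟨ih.1.trans (hM hm).1.to_reflTransGen, ih.2.trans (hM hm).2⟩
    exact ⟨u, .head hm this.1, by omega⟩

end Assignments

/-! ### Minimum-cost flows and optimal assignments -/

section FlowOfAssignment

variable {n : ℕ} {D : Fin n → Finset ℤ}

theorem mem_valueSet {i : Fin n} {d : ℤ} (h : d ∈ D i) : d ∈ valueSet D :=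
  Finset.mem_biUnion.2 ⟨i, Finset.mem_univ _, h⟩

theorem count_le_mult {x : Fin n → ℤ} (hx : ∀ i, x i ∈ D i) (d : ℤ) :
    count x d ≤ mult D d := by
  rw [count, mult, Finset.card_filter]
  push_cast
  refine Finset.sum_le_sum fun i _ => ?_
  split_ifs with h1 h2
  · rfl
  · exact absurd (h1 ▸ hx i) h2
  · norm_num
  · rfl

theorem tail_inl (i : Fin n) : (network D).tail (.inl i) = .source := rfl

theorem tail_varArc (a : VarArc D) : (network D).tail (.inr (.inl a)) = .var a.1 := rfl

theorem tail_inr (b : Σ d : {d // d ∈ valueSet D}, Fin (mult D d)) :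
    (network D).tail (.inr (.inr b)) = .val b.1 := rfl

theorem head_inl (i : Fin n) : (network D).head (.inl i) = .var i := rfl

theorem head_varArc (a : VarArc D) :
    (network D).head (.inr (.inl a)) = .val ⟨a.2.1, mem_valueSet a.2.2⟩ := rfl

theorem head_inr (b : Σ d : {d // d ∈ valueSet D}, Fin (mult D d)) :
    (network D).head (.inr (.inr b)) = .sink := rfl

theorem outflow_source (f : Arc D → ℝ) :
    (network D).outflow f .source = ∑ i, f (.inl i) := by
  simp [Network.outflow, Finset.sum_filter, Fintype.sum_sum_type, tail_inl, tail_varArc, tail_inr]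

theorem inflow_source (f : Arc D → ℝ) : (network D).inflow f .source = 0 := by
  simp [Network.inflow, Finset.sum_filter, Fintype.sum_sum_type, head_inl, head_varArc, head_inr]

theorem outflow_var (f : Arc D → ℝ) (i : Fin n) :
    (network D).outflow f (.var i) = ∑ d : {d // d ∈ D i}, f (varArc D ⟨i, d⟩) := by
  simp only [Network.outflow, Finset.sum_filter, Fintype.sum_sum_type, Fintype.sum_sigma,
    tail_inl, tail_varArc, tail_inr]
  simp only [reduceCtorEq, if_false, Finset.sum_const_zero, zero_add, add_zero, Vertex.var.injEq]
  rw [Finset.sum_eq_single i (fun j _ hj => by simp [hj]) (by simp)]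
  simp

theorem inflow_var (f : Arc D → ℝ) (i : Fin n) :
    (network D).inflow f (.var i) = f (.inl i) := by
  simp [Network.inflow, Finset.sum_filter, Fintype.sum_sum_type, head_inl, head_varArc, head_inr]

theorem outflow_val (f : Arc D → ℝ) (d : {d // d ∈ valueSet D}) :
    (network D).outflow f (.val d) = ∑ j : Fin (mult D d), f (.inr (.inr ⟨d, j⟩)) := by
  simp only [Network.outflow, Finset.sum_filter, Fintype.sum_sum_type, Fintype.sum_sigma,
    tail_inl, tail_varArc, tail_inr]
  simp only [reduceCtorEq, if_false, Finset.sum_const_zero, zero_add, Vertex.val.injEq]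
  rw [Finset.sum_eq_single d (fun j _ hj => by simp [hj]) (by simp)]
  simp

theorem inflow_val (f : Arc D → ℝ) (d : {d // d ∈ valueSet D}) :
    (network D).inflow f (.val d) =
      ∑ i, ∑ e : {e // e ∈ D i}, if (e : ℤ) = d then f (varArc D ⟨i, e⟩) else 0 := by
  simp only [Network.inflow, Finset.sum_filter, Fintype.sum_sum_type, Fintype.sum_sigma,
    head_inl, head_varArc, head_inr]
  simp [Subtype.ext_iff]

theorem cost_eq (f : Arc D → ℝ) : (network D).cost f =
    ∑ d : {d // d ∈ valueSet D}, ∑ j : Fin (mult D d), (j : ℝ) * f (.inr (.inr ⟨d, j⟩)) := by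
  simp [Network.cost, network, Fintype.sum_sum_type, Fintype.sum_sigma]

variable (D) in
/-- The flow that sends one unit along each `(x i, τ i)`, and uses the cheapest arcs to the
sink. -/
noncomputable def flowOf (τ : Fin n → ℤ) : Arc D → ℝ
  | .inl _ => 1
  | .inr (.inl a) => if (a.2 : ℤ) = τ a.1 then 1 else 0
  | .inr (.inr b) => if ((b.2 : ℕ) : ℤ) < count τ b.1 then 1 else 0

theorem sum_fin_ite_lt {R : Type*} [AddCommMonoid R] {k : ℕ} {c : ℤ} (hc : 0 ≤ c) (hck : c ≤ k)
    (g : ℕ → R) :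
    ∑ j : Fin k, (if ((j : ℕ) : ℤ) < c then g j else 0) = ∑ j ∈ Finset.range c.toNat, g j := by
  rw [Fin.sum_univ_eq_sum_range (fun j => if ((j : ℕ) : ℤ) < c then g j else 0) k,
    ← Finset.sum_filter]
  congr 1
  ext j
  simp only [Finset.mem_filter, Finset.mem_range]
  omega

theorem flowOf_isFeasibleFlow {τ : Fin n → ℤ} (hτ : ∀ i, τ i ∈ D i) :
    (network D).IsFeasibleFlow (flowOf D τ) where
  nonneg a := by
    rcases a with i | a | b <;> simp only [flowOf] <;> positivity
  le_cap a := by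
    rcases a with i | a | b <;> simp only [flowOf, network] <;> first | rfl | (split_ifs <;> norm_num)
  conservation v hs ht := by
    rcases v with _ | _ | i | d
    · exact absurd rfl hs
    · exact absurd rfl ht
    · rw [outflow_var, inflow_var]
      simp only [flowOf]
      rw [Finset.sum_eq_single ⟨τ i, hτ i⟩ (fun e _ he => if_neg fun h => he (Subtype.ext h))
        (by simp)]
      simp
    · rw [outflow_val, inflow_val]
      simp only [flowOf]
      rw [sum_fin_ite_lt (count_nonneg _ _) (count_le_mult hτ _) fun _ => (1 : ℝ)]
      have h1 : ∀ i, (∑ e : {e // e ∈ D i}, if (e : ℤ) = d then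
          (if (e : ℤ) = τ i then (1 : ℝ) else 0) else 0) = if τ i = d then 1 else 0 := by
        intro i
        rw [Finset.sum_eq_single ⟨τ i, hτ i⟩
          (fun e _ he => by simp [show (e : ℤ) ≠ τ i from fun h => he (Subtype.ext h)]) (by simp)]
        simp
      rw [Finset.sum_congr rfl fun i _ => h1 i]
      have h2 : ((count τ d).toNat : ℤ) = count τ d := Int.toNat_of_nonneg (count_nonneg _ _)
      have h3 : ((count τ d : ℤ) : ℝ) = ∑ i, if τ i = d then (1 : ℝ) else 0 := by
        rw [count]; push_cast; rfl
      rw [← h3, Finset.sum_const, Finset.card_range, nsmul_one]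
      exact_mod_cast congrArg (Int.cast : ℤ → ℝ) h2

theorem sum_range_toNat_id {c : ℤ} (hc : 0 ≤ c) :
    2 * ∑ j ∈ Finset.range c.toNat, (j : ℝ) = c * (c - 1) := by
  obtain ⟨k, rfl⟩ := Int.eq_ofNat_of_zero_le hc
  simp only [Int.toNat_natCast, Int.cast_natCast]
  induction k with
  | zero => simp
  | succ k ih =>
    rw [Finset.sum_range_succ, mul_add, ih (by positivity)]
    push_cast
    ring

theorem two_mul_violation_cast {τ : Fin n → ℤ} (hτ : ∀ i, τ i ∈ D i) :
    2 * (violation τ : ℝ) =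
      ∑ d : {d // d ∈ valueSet D}, (count τ d : ℝ) * (count τ d - 1) := by
  have h := two_mul_violation τ fun i => mem_valueSet (hτ i)
  rw [← Finset.sum_coe_sort] at h
  exact_mod_cast h

/-- The cheapest `c` parallel arcs cost `0 + 1 + ⋯ + (c - 1)`, the number of pairs among `c`
variables. -/
theorem cost_flowOf {τ : Fin n → ℤ} (hτ : ∀ i, τ i ∈ D i) :
    (network D).cost (flowOf D τ) = violation τ := by
  refine mul_left_cancel₀ (two_ne_zero (α := ℝ)) ?_
  rw [two_mul_violation_cast hτ, cost_eq, Finset.mul_sum]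
  refine Finset.sum_congr rfl fun d _ => ?_
  simp only [flowOf, mul_ite, mul_one, mul_zero]
  rw [sum_fin_ite_lt (count_nonneg _ _) (count_le_mult hτ _) fun j => (j : ℝ),
    sum_range_toNat_id (count_nonneg _ _)]

theorem value_flowOf (τ : Fin n → ℤ) : (network D).value (flowOf D τ) = n := by
  rw [Network.value, show (network D).s = .source from rfl, outflow_source, inflow_source]
  simp [flowOf]

/-- Filling the cheapest arcs first is cheapest. -/
theorem le_sum_id_mul {k : ℕ} {c : ℤ} (hc : 0 ≤ c) (hck : c ≤ k) (g : Fin k → ℝ)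
    (h0 : ∀ j, 0 ≤ g j) (h1 : ∀ j, g j ≤ 1) (hg : ∑ j, g j = c) :
    (c : ℝ) * (c - 1) ≤ 2 * ∑ j : Fin k, (j : ℝ) * g j := by
  rw [← sum_range_toNat_id hc, ← sum_fin_ite_lt hc hck]
  have h2 : ∑ j : Fin k, (if ((j : ℕ) : ℤ) < c then (1 : ℝ) else 0) = c := by
    rw [sum_fin_ite_lt hc hck fun _ => (1 : ℝ)]
    obtain ⟨c, rfl⟩ := Int.eq_ofNat_of_zero_le hc
    simp
  -- The exchange argument as one inequality: `g` is at most the greedy filling below the threshold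
  -- `c` and at least that from `c` on, so each product is nonnegative. Equal totals make the shift
  -- by `c` cancel.
  have h3 : 0 ≤ ∑ j : Fin k, ((j : ℝ) - c) * (g j - if ((j : ℕ) : ℤ) < c then 1 else 0) := by
    refine Finset.sum_nonneg fun j _ => ?_
    split_ifs with h
    · have : ((j : ℕ) : ℝ) < c := by exact_mod_cast h
      exact mul_nonneg_of_nonpos_of_nonpos (by linarith) (by linarith [h1 j])
    · have : (c : ℝ) ≤ (j : ℕ) := by exact_mod_cast not_lt.1 h
      exact mul_nonneg (by linarith) (by linarith [h0 j])
  have h4 : ∑ j : Fin k, ((j : ℝ) - c) * (g j - if ((j : ℕ) : ℤ) < c then 1 else 0) =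
      (∑ j : Fin k, (j : ℝ) * g j - ∑ j : Fin k, if ((j : ℕ) : ℤ) < c then ((j : ℕ) : ℝ) else 0)
      - c * (∑ j, g j - ∑ j : Fin k, if ((j : ℕ) : ℤ) < c then (1 : ℝ) else 0) := by
    rw [← Finset.sum_sub_distrib, ← Finset.sum_sub_distrib, Finset.mul_sum,
      ← Finset.sum_sub_distrib]
    refine Finset.sum_congr rfl fun j _ => ?_
    split_ifs <;> ring
  rw [hg, h2, sub_self, mul_zero, sub_zero] at h4
  linarith

/-- An integral minimum-cost flow is an assignment of least violation. -/
theorem exists_isOptimal_of_isMinCostFlow {f : Arc D → ℤ} (hD : ∀ i, (D i).Nonempty)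
    (hf : (network D).IsMinCostFlow fun a => (f a : ℝ)) :
    ∃ a : Fin n → ℤ, IsOptimal D a ∧
      ∀ p : VarArc D, f (varArc D p) = if (p.2 : ℤ) = a p.1 then 1 else 0 := by
  obtain ⟨hfeas, hmax, hmin⟩ := hf
  have h0 : ∀ a, 0 ≤ f a := fun a => by exact_mod_cast hfeas.nonneg a
  have h1 : ∀ a, f a ≤ 1 := fun a => by
    have : (f a : ℝ) ≤ 1 := hfeas.le_cap a
    exact_mod_cast this
  -- Any assignment yields a flow of value `n`, so a maximum flow saturates every arc at the source.
  choose τ₀ hτ₀ using hD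
  have hval : (network D).value (fun a => (f a : ℝ)) = ∑ i, (f (.inl i) : ℝ) := by
    rw [Network.value, show (network D).s = .source from rfl, outflow_source, inflow_source,
      sub_zero]
  have hsum : (n : ℤ) ≤ ∑ i, f (.inl i) := by
    have := hmax _ (flowOf_isFeasibleFlow hτ₀)
    rw [value_flowOf, hval] at this
    exact_mod_cast this
  have hs : ∀ i, f (.inl i) = 1 := by
    have h2 : ∑ i : Fin n, (1 - f (.inl i)) ≤ 0 := by
      rw [Finset.sum_sub_distrib]; simpa using hsum
    have h3 := (Finset.sum_eq_zero_iff_of_nonneg fun (i : Fin n) _ =>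
      sub_nonneg.2 (h1 (.inl i))).1 (le_antisymm h2 (Finset.sum_nonneg fun i _ =>
        sub_nonneg.2 (h1 (.inl i))))
    intro i
    have := h3 i (Finset.mem_univ i)
    omega
  have hvar : ∀ i, ∑ d : {d // d ∈ D i}, f (varArc D ⟨i, d⟩) = 1 := by
    intro i
    have := hfeas.conservation (.var i) (by simp [network]) (by simp [network])
    rw [outflow_var, inflow_var, hs i] at this
    exact_mod_cast this
  have hex : ∀ i, ∃ d : {d // d ∈ D i}, ∀ e : {d // d ∈ D i},
      f (varArc D ⟨i, e⟩) = if e = d then 1 else 0 := by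
    intro i
    have hne : ∃ d : {d // d ∈ D i}, f (varArc D ⟨i, d⟩) ≠ 0 := by
      by_contra! hall
      have := hvar i
      rw [Finset.sum_eq_zero fun d _ => hall d] at this
      exact absurd this (by norm_num)
    obtain ⟨d, hd⟩ := hne
    have hd1 : f (varArc D ⟨i, d⟩) = 1 := by
      have := h0 (varArc D ⟨i, d⟩)
      have := h1 (varArc D ⟨i, d⟩)
      omega
    refine ⟨d, fun e => ?_⟩
    split_ifs with he
    · rw [he, hd1]
    · have h2 := hvar i
      rw [← Finset.add_sum_erase _ _ (Finset.mem_univ d), hd1] at h2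
      have h3 : ∑ e ∈ Finset.univ.erase d, f (varArc D ⟨i, e⟩) = 0 := by omega
      exact (Finset.sum_eq_zero_iff_of_nonneg fun e _ => h0 _).1 h3 e (by simp [he])
  choose a ha using hex
  have hfa : ∀ p : VarArc D, f (varArc D p) = if (p.2 : ℤ) = a p.1 then 1 else 0 := by
    rintro ⟨i, d⟩
    rw [ha i d]
    exact if_congr Subtype.ext_iff rfl rfl
  have haD : ∀ i, (a i : ℤ) ∈ D i := fun i => (a i).2
  refine ⟨fun i => a i, ⟨haD, fun τ hτ => ?_⟩, hfa⟩
  have hcost := hmin _ (flowOf_isFeasibleFlow hτ) (by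
    rw [value_flowOf, hval]; simp [hs])
  rw [cost_flowOf hτ] at hcost
  -- Only this inequality is needed: whichever parallel arcs `f` uses, it costs at least as much as
  -- filling the cheapest ones.
  have hle : (violation fun i => (a i : ℤ) : ℝ) ≤ (network D).cost fun a => (f a : ℝ) := by
    refine le_of_mul_le_mul_left ?_ (two_pos (α := ℝ))
    rw [two_mul_violation_cast haD, cost_eq, Finset.mul_sum]
    refine Finset.sum_le_sum fun d _ => le_sum_id_mul (count_nonneg _ _) (count_le_mult haD _) _
      (fun j => by exact_mod_cast h0 _) (fun j => by exact_mod_cast h1 _) ?_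
    have := hfeas.conservation (.val d) (by simp [network]) (by simp [network])
    rw [outflow_val, inflow_val] at this
    rw [this, count]
    push_cast
    refine Finset.sum_congr rfl fun i _ => ?_
    rw [Finset.sum_eq_single (a i) (fun e _ he => by
      rw [ha i e, if_neg he]; simp) (by simp), ha i (a i)]
    simp
  exact_mod_cast hle.trans hcost

end FlowOfAssignment

/-! ### Depth-first search -/

section Search

/-- The configuration of a depth-first search: the roots that have been started and those that
have not, the stack, the finished vertices (last finished first), the arcs not yet explored, the
root from which a vertex was found, and the current root. -/
structure Config where
  old : List ℤ
  todo : List ℤ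
  stack : List ℤ
  fin : List ℤ
  adj : ℤ → List ℤ
  lab : ℤ → ℤ
  cur : ℤ

/-- The vertices found so far. -/
def Config.Seen (c : Config) (v : ℤ) : Prop := v ∈ c.stack ∨ v ∈ c.fin

/-- The number of roots and arcs that are still to be explored. -/
def Config.work (V : Finset ℤ) (c : Config) : ℕ := c.todo.length + ∑ u ∈ V, (c.adj u).length

/-- `r` is the first element of `R` from which `v` can be reached. -/
def FirstRoot (E : ℤ → ℤ → Prop) (R : List ℤ) (v r : ℤ) : Prop :=
  ReflTransGen E r v ∧ ∃ pre post, R = pre ++ r :: post ∧ ∀ x ∈ pre, ¬ ReflTransGen E x v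

/-- If an arc leads from `u` to a vertex `w` in front of `u`, then `w` reaches everything between
`w` and `u`. -/
def BackReach (E : ℤ → ℤ → Prop) (F : List ℤ) : Prop :=
  ∀ A w B u C, F = A ++ w :: (B ++ u :: C) → E u w → ∀ x ∈ B ++ [u], ReflTransGen E w x

variable {E : ℤ → ℤ → Prop}

/-- The last element in Kosaraju's algorithm: the first vertex of a depth-first finishing order
that `v` reaches also reaches `v`. -/
theorem BackReach.reach_of_first {F : List ℤ} (hF : BackReach E F)
    (hE : ∀ u w, u ∈ F → E u w → w ∈ F) {pre post : List ℤ} {r v : ℤ}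
    (hr : F = pre ++ r :: post) (hv : v ∈ F) (hvr : ReflTransGen E v r)
    (hpre : ∀ x ∈ pre, ¬ ReflTransGen E v x) : ReflTransGen E r v := by
  -- Strengthened for an induction along the path from `v` to `r`: `r` reaches the whole segment up
  -- to `v`. The next vertex cannot precede `r`. If it is `r` or lies between `r` and `v`,
  -- `BackReach` covers the segment from it to `v`; if it lies behind `v`, its own segment contains
  -- that of `v`.
  have key : v ≠ r → ∀ B C, F = pre ++ r :: (B ++ v :: C) →
      ∀ x ∈ B ++ [v], ReflTransGen E r x := by
    clear hr
    induction hvr using ReflTransGen.head_induction_on with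
    | refl => exact fun h => absurd rfl h
    | @head u w huw hwr ih =>
      intro _ B C hBC x hx
      by_cases hw : w = r
      · subst hw
        exact hF pre w B u C hBC huw x hx
      have ih := ih (hE u w hv huw) (fun x hx hwx => hpre x hx (.head huw hwx)) hw
      have hwF := hE u w hv huw
      rw [hBC] at hwF
      simp only [List.mem_append, List.mem_cons, hw, false_or] at hwF
      rcases hwF with hwp | hwB | rfl | hwC
      · exact absurd (.single huw) (hpre w hwp)
      · obtain ⟨B₁, B₂, rfl⟩ := List.append_of_mem hwB
        have h1 := ih B₁ (B₂ ++ u :: C) (by rw [hBC]; simp)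
        have h2 := hF (pre ++ r :: B₁) w B₂ u C (by rw [hBC]; simp) huw
        simp only [List.append_assoc, List.cons_append, List.mem_append, List.mem_cons] at hx
        rcases hx with hx | rfl | hx
        · exact h1 x (by simp [hx])
        · exact h1 x (by simp)
        · exact (h1 w (by simp)).trans (h2 x (by simpa using hx))
      · exact ih B C hBC x hx
      · obtain ⟨C₁, C₂, rfl⟩ := List.append_of_mem hwC
        refine ih (B ++ u :: C₁) C₂ (by rw [hBC]; simp) x ?_
        simp only [List.mem_append, List.mem_cons, List.not_mem_nil, or_false] at hx ⊢
        tauto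
  by_cases hvr' : v = r
  · rw [hvr']
  rw [hr] at hv
  simp only [List.mem_append, List.mem_cons, hvr', false_or] at hv
  rcases hv with hv | hv
  · exact absurd .refl (hpre v hv)
  · obtain ⟨B, C, rfl⟩ := List.append_of_mem hv
    exact key hvr' B C hr v (by simp)

/-- The invariant of a depth-first search from the roots `R`. -/
structure SearchInv (E : ℤ → ℤ → Prop) (R : List ℤ) (c : Config) : Prop where
  roots : R = c.old ++ c.todo
  old_seen : ∀ r ∈ c.old, c.Seen r
  stack_reach : c.stack.Pairwise fun x y => ReflTransGen E y x
  fin_closed : ∀ u ∈ c.fin, ∀ w, E u w → c.Seen w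
  adj_sub : ∀ u, ∀ w ∈ c.adj u, E u w
  stack_adj : ∀ u ∈ c.stack, ∀ w, E u w → w ∈ c.adj u ∨ c.Seen w
  unseen_adj : ∀ u, ¬ c.Seen u → ∀ w, E u w → w ∈ c.adj u
  back_stack : ∀ A u C, c.fin = A ++ u :: C → ∀ w, E u w → w ∈ c.stack →
    ∀ x ∈ A ++ [u], ReflTransGen E w x
  back_fin : BackReach E c.fin
  lab_first : ∀ v, c.Seen v → FirstRoot E R v (c.lab v)
  current : c.stack ≠ [] → ∃ pre, c.old = pre ++ [c.cur] ∧
    (∀ v ∈ c.stack, ReflTransGen E c.cur v) ∧ ∀ v, ¬ c.Seen v → ∀ x ∈ pre, ¬ ReflTransGen E x v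

variable {R : List ℤ} {c : Config}

theorem SearchInv.initial {adj : ℤ → List ℤ} (h : ∀ u w, w ∈ adj u ↔ E u w) (lab : ℤ → ℤ)
    (cur : ℤ) : SearchInv E R ⟨[], R, [], [], adj, lab, cur⟩ where
  roots := rfl
  old_seen := by simp
  stack_reach := .nil
  fin_closed := by simp
  adj_sub u w hw := (h u w).1 hw
  stack_adj := by simp
  unseen_adj u _ w hw := (h u w).2 hw
  back_stack := by simp
  back_fin := by simp [BackReach]
  lab_first v hv := by simp [Config.Seen] at hv
  current := by simp

/-- Every vertex below `u` on the stack reaches `u`, so a stacked vertex reaches all that finishes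
above it. This maintains `back_stack`, which turns into `back_fin` for arcs into `u` when `u` itself
finishes. -/
theorem SearchInv.pop (h : SearchInv E R c) {u : ℤ} {s : List ℤ} (hs : c.stack = u :: s)
    (hu : c.adj u = []) : SearchInv E R { c with stack := s, fin := u :: c.fin } := by
  have hseen : ∀ v, Config.Seen { c with stack := s, fin := u :: c.fin } v ↔ c.Seen v := by
    intro v
    simp only [Config.Seen, hs, List.mem_cons]
    tauto
  have hp := h.stack_reach
  rw [hs, List.pairwise_cons] at hp
  constructor
  · exact h.roots
  · simpa only [hseen] using h.old_seen
  · exact hp.2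
  · simp only [hseen, List.mem_cons, forall_eq_or_imp]
    refine ⟨fun w hw => (h.stack_adj u (by simp [hs]) w hw).resolve_left (by simp [hu]),
      h.fin_closed⟩
  · exact h.adj_sub
  · simp only [hseen]
    exact fun v hv => h.stack_adj v (by simp [hs, hv])
  · simpa only [hseen] using h.unseen_adj
  · intro A v C hA w hw hws x hx
    rcases A with _ | ⟨y, A⟩
    · obtain ⟨rfl, rfl⟩ : u = v ∧ c.fin = C := by simpa using hA
      obtain rfl : x = u := by simpa using hx
      exact hp.1 w hws
    · obtain ⟨rfl, hA'⟩ : u = y ∧ c.fin = A ++ v :: C := by simpa using hA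
      rw [List.cons_append, List.mem_cons] at hx
      rcases hx with rfl | hx
      · exact hp.1 w hws
      · exact h.back_stack A v C hA' w hw (by simp [hs, hws]) x hx
  · intro A w B v C hA hw x hx
    rcases A with _ | ⟨y, A⟩
    · obtain ⟨rfl, hA'⟩ : u = w ∧ c.fin = B ++ v :: C := by simpa using hA
      exact h.back_stack B v C hA' u hw (by simp [hs]) x hx
    · obtain ⟨rfl, hA'⟩ : u = y ∧ c.fin = A ++ w :: (B ++ v :: C) := by simpa using hA
      exact h.back_fin A w B v C hA' hw x hx
  · simpa only [hseen] using h.lab_first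
  · intro _
    obtain ⟨pre, h1, h2, h3⟩ := h.current (by simp [hs])
    refine ⟨pre, h1, fun v hv => h2 v (by simp [hs, hv]), ?_⟩
    simpa only [hseen] using h3

theorem SearchInv.skip (h : SearchInv E R c) {u w : ℤ} {l : List ℤ} (hu : c.adj u = w :: l)
    (hus : c.Seen u) (hw : c.Seen w) :
    SearchInv E R { c with adj := Function.update c.adj u l } := by
  have hadj : ∀ v, ∀ x ∈ Function.update c.adj u l v, x ∈ c.adj v := by
    intro v x hx
    rcases eq_or_ne v u with rfl | hv
    · rw [Function.update_self] at hx; simp [hu, hx]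
    · rwa [Function.update_of_ne hv] at hx
  refine ⟨h.roots, h.old_seen, h.stack_reach, h.fin_closed,
    fun v x hx => h.adj_sub v x (hadj v x hx), fun v hv x hx => ?_, fun v hv x hx => ?_,
    h.back_stack, h.back_fin, h.lab_first, h.current⟩
  · rcases h.stack_adj v hv x hx with h1 | h1
    · rcases eq_or_ne v u with rfl | hvu
      · rw [hu, List.mem_cons] at h1
        rcases h1 with rfl | h1
        · exact .inr hw
        · left; simpa using h1
      · left; simpa [hvu] using h1
    · exact .inr h1
  · have hvu : v ≠ u := by rintro rfl; exact hv hus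
    simpa [hvu] using h.unseen_adj v hv x hx

/-- Since `w` is unseen, `current` says that no earlier root reaches it, so the current root is the
right label. No finished vertex has an arc to `w`, so `back_stack` gains no new case. -/
theorem SearchInv.push_of_adj (h : SearchInv E R c) {u w : ℤ} {s l : List ℤ}
    (hs : c.stack = u :: s) (hu : c.adj u = w :: l) (hw : ¬ c.Seen w) :
    SearchInv E R { c with
      adj := Function.update c.adj u l
      stack := w :: c.stack
      lab := Function.update c.lab w c.cur } := by
  have huw : E u w := h.adj_sub u w (by simp [hu])
  have hseen : ∀ (a : ℤ → List ℤ) (b : ℤ → ℤ) (v : ℤ), Config.Seen { c with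
      adj := a, stack := w :: c.stack, lab := b } v ↔ v = w ∨ c.Seen v := by
    intro a b v
    simp only [Config.Seen, List.mem_cons]
    tauto
  have hadj : ∀ v, ∀ x ∈ Function.update c.adj u l v, x ∈ c.adj v := by
    intro v x hx
    rcases eq_or_ne v u with rfl | hv
    · rw [Function.update_self] at hx; simp [hu, hx]
    · rwa [Function.update_of_ne hv] at hx
  have hreach : ∀ v ∈ c.stack, ReflTransGen E v w := by
    intro v hv
    refine ReflTransGen.tail ?_ huw
    have hp := h.stack_reach
    rw [hs, List.pairwise_cons] at hp
    rw [hs, List.mem_cons] at hv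
    rcases hv with rfl | hv
    · rfl
    · exact hp.1 v hv
  obtain ⟨pre, h1, h2, h3⟩ := h.current (by simp [hs])
  constructor
  · exact h.roots
  · intro r hr
    rw [hseen]
    exact .inr (h.old_seen r hr)
  · exact List.pairwise_cons.2 ⟨hreach, h.stack_reach⟩
  · intro v hv x hx
    rw [hseen]
    exact .inr (h.fin_closed v hv x hx)
  · exact fun v x hx => h.adj_sub v x (hadj v x hx)
  · intro v hv x hx
    rw [hseen]
    simp only [List.mem_cons] at hv ⊢
    have h4 : x ∈ c.adj v ∨ c.Seen x := by
      rcases hv with rfl | hv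
      · exact .inl (h.unseen_adj v hw x hx)
      · exact h.stack_adj v hv x hx
    rcases h4 with h4 | h4
    · rcases eq_or_ne v u with rfl | hvu
      · rw [hu, List.mem_cons] at h4
        rcases h4 with rfl | h4
        · exact .inr (.inl rfl)
        · left; simpa using h4
      · left; simpa [hvu] using h4
    · exact .inr (.inr h4)
  · intro v hv x hx
    rw [hseen, not_or] at hv
    have hvu : v ≠ u := by rintro rfl; exact hv.2 (.inl (by simp [hs]))
    simpa [hvu] using h.unseen_adj v hv.2 x hx
  · intro A v C hA x hx hxs y hy
    simp only [List.mem_cons] at hxs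
    rcases hxs with rfl | hxs
    · exact absurd (h.fin_closed v (by rw [show c.fin = _ from hA]; simp) x hx) hw
    · exact h.back_stack A v C hA x hx hxs y hy
  · exact h.back_fin
  · intro v hv
    rw [hseen] at hv
    by_cases hvw : v = w
    · subst hvw
      simp only [Function.update_self]
      refine ⟨(h2 u (by simp [hs])).tail huw, pre, c.todo, ?_, h3 v hw⟩
      rw [h.roots, h1]
      simp
    · simp only [ne_eq, hvw, not_false_eq_true, Function.update_of_ne]
      exact h.lab_first v (hv.resolve_left hvw)
  · intro _
    refine ⟨pre, h1, fun v hv => ?_, fun v hv => ?_⟩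
    · simp only [List.mem_cons] at hv
      rcases hv with rfl | hv
      · exact (h2 u (by simp [hs])).tail huw
      · exact h2 v hv
    · rw [hseen, not_or] at hv
      exact h3 v hv.2

theorem SearchInv.skip_root (h : SearchInv E R c) {r : ℤ} {t : List ℤ} (hs : c.stack = [])
    (ht : c.todo = r :: t) (hr : c.Seen r) :
    SearchInv E R { c with old := c.old ++ [r], todo := t, cur := r } := by
  refine ⟨by rw [h.roots, ht]; simp, fun x hx => ?_, h.stack_reach, h.fin_closed, h.adj_sub,
    h.stack_adj, h.unseen_adj, h.back_stack, h.back_fin, h.lab_first,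
    fun hne => absurd hs hne⟩
  rcases List.mem_append.1 hx with hx | hx
  · exact h.old_seen x hx
  · rwa [List.mem_singleton.1 hx]

/-- With an empty stack all seen vertices are finished, hence closed under arcs. A new root thus
starts with the certainty that no earlier root reaches an unseen vertex. -/
theorem SearchInv.reach_seen (h : SearchInv E R c) (hs : c.stack = []) {u v : ℤ}
    (hu : c.Seen u) (huv : ReflTransGen E u v) : c.Seen v := by
  induction huv with
  | refl => exact hu
  | tail _ hE ih => exact h.fin_closed _ (ih.resolve_left (by simp [hs])) _ hE

theorem SearchInv.push_root (h : SearchInv E R c) {r : ℤ} {t : List ℤ} (hs : c.stack = [])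
    (ht : c.todo = r :: t) (hr : ¬ c.Seen r) :
    SearchInv E R { c with
      old := c.old ++ [r]
      todo := t
      cur := r
      stack := r :: c.stack
      lab := Function.update c.lab r r } := by
  have hseen : ∀ a b (e : ℤ → ℤ) d (v : ℤ), Config.Seen { c with
      old := a, todo := b, cur := d, stack := r :: c.stack, lab := e } v ↔ v = r ∨ c.Seen v := by
    intro a b e d v
    simp only [Config.Seen, List.mem_cons]
    tauto
  have hunseen : ∀ v, ¬ c.Seen v → ∀ x ∈ c.old, ¬ ReflTransGen E x v :=
    fun v hv x hx hxv => hv (h.reach_seen hs (h.old_seen x hx) hxv)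
  have hroots : R = c.old ++ r :: t := by rw [h.roots, ht]
  constructor
  · rw [hroots]; simp
  · intro x hx
    rw [hseen]
    rcases List.mem_append.1 hx with hx | hx
    · exact .inr (h.old_seen x hx)
    · exact .inl (List.mem_singleton.1 hx)
  · simp [hs]
  · intro v hv x hx
    rw [hseen]
    exact .inr (h.fin_closed v hv x hx)
  · exact h.adj_sub
  · intro v hv x hx
    simp only [hs, List.mem_singleton] at hv
    subst hv
    exact .inl (h.unseen_adj v hr x hx)
  · intro v hv x hx
    rw [hseen, not_or] at hv
    exact h.unseen_adj v hv.2 x hx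
  · intro A v C hA x hx hxs y hy
    simp only [hs, List.mem_singleton] at hxs
    subst hxs
    exact absurd (h.fin_closed v (by rw [show c.fin = _ from hA]; simp) x hx) hr
  · exact h.back_fin
  · intro v hv
    rw [hseen] at hv
    by_cases hvr : v = r
    · subst hvr
      simp only [Function.update_self]
      exact ⟨.refl, c.old, t, hroots, hunseen v hr⟩
    · simp only [ne_eq, hvr, not_false_eq_true, Function.update_of_ne]
      exact h.lab_first v (hv.resolve_left hvr)
  · intro _
    refine ⟨c.old, rfl, fun v hv => ?_, fun v hv => ?_⟩
    · simp only [hs, List.mem_singleton] at hv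
      rw [hv]
    · rw [hseen, not_or] at hv
      exact hunseen v hv.2

/-- The result of a complete depth-first search from the roots `R`. -/
structure SearchResult (E : ℤ → ℤ → Prop) (R F : List ℤ) (lab : ℤ → ℤ) : Prop where
  root_mem : ∀ r ∈ R, r ∈ F
  closed : ∀ u w, u ∈ F → E u w → w ∈ F
  back : BackReach E F
  first : ∀ v ∈ F, FirstRoot E R v (lab v)

theorem SearchInv.result (h : SearchInv E R c) (hs : c.stack = []) (ht : c.todo = []) :
    SearchResult E R c.fin c.lab := by
  have hseen : ∀ v, c.Seen v ↔ v ∈ c.fin := by simp [Config.Seen, hs]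
  constructor
  · intro r hr
    rw [h.roots, ht, List.append_nil] at hr
    exact (hseen r).1 (h.old_seen r hr)
  · exact fun u w hu hE => (hseen w).1 (h.fin_closed u hu w hE)
  · exact h.back_fin
  · exact fun v hv => h.lab_first v ((hseen v).2 hv)

theorem SearchResult.mem_iff {F : List ℤ} {lab : ℤ → ℤ} (h : SearchResult E R F lab) (v : ℤ) :
    v ∈ F ↔ ∃ r ∈ R, ReflTransGen E r v := by
  constructor
  · intro hv
    obtain ⟨h1, pre, post, h2, -⟩ := h.first v hv
    exact ⟨_, by rw [h2]; simp, h1⟩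
  · rintro ⟨r, hr, hrv⟩
    induction hrv with
    | refl => exact h.root_mem r hr
    | tail _ hE ih => exact h.closed _ _ ih hE

/-- Kosaraju's algorithm: a search of the reverse graph, from the vertices in the finishing order
of a search of the graph, finds the strongly connected components. -/
theorem SearchResult.lab_eq_iff {F F' : List ℤ} {lab lab' : ℤ → ℤ} (h : SearchResult E R F lab)
    (h' : SearchResult (fun u w => E w u) F F' lab') {u v : ℤ} (hu : u ∈ F) (hv : v ∈ F) :
    lab' u = lab' v ↔ ReflTransGen E u v ∧ ReflTransGen E v u := by
  have hswap : ∀ x y, ReflTransGen (fun u w => E w u) x y ↔ ReflTransGen E y x :=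
    fun x y => reflTransGen_swap
  -- Searching the reverse graph labels `v` with the first vertex of `F` that `v` reaches.
  -- `BackReach.reach_of_first` supplies the way back, so the label represents the component.
  have hlab : ∀ v ∈ F, ReflTransGen E v (lab' v) ∧ ReflTransGen E (lab' v) v ∧
      ∃ pre post, F = pre ++ lab' v :: post ∧ ∀ x ∈ pre, ¬ ReflTransGen E v x := by
    intro v hv
    obtain ⟨h1, pre, post, h2, h3⟩ := h'.first v (h'.root_mem v hv)
    simp only [hswap] at h1 h3
    exact ⟨h1, h.back.reach_of_first h.closed h2 hv h1 h3, pre, post, h2, h3⟩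
  obtain ⟨hu1, hu2, pre, post, hu3, hu4⟩ := hlab u hu
  obtain ⟨hv1, hv2, pre', post', hv3, hv4⟩ := hlab v hv
  constructor
  · intro heq
    exact ⟨hu1.trans (heq ▸ hv2), hv1.trans (heq ▸ hu2)⟩
  · rintro ⟨huv, hvu⟩
    rw [hu3, List.append_eq_append_iff] at hv3
    rcases hv3 with ⟨as, h1, h2⟩ | ⟨as, h1, h2⟩
    · rcases as with _ | ⟨x, as⟩
      · exact (List.cons.inj h2).1
      · obtain ⟨rfl, -⟩ := List.cons.inj h2
        exact absurd (hvu.trans hu1) (hv4 _ (by simp [h1]))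
    · rcases as with _ | ⟨x, as⟩
      · exact (List.cons.inj h2).1.symm
      · obtain ⟨rfl, -⟩ := List.cons.inj h2
        exact absurd (huv.trans hv1) (hu4 _ (by simp [h1]))

end Search

/-! ### Running programs -/

section Machine

/-- Whether a program is free of loops. -/
def Program.LoopFree : Program → Prop
  | .skip => True
  | .assign _ _ => True
  | .store _ _ _ => True
  | .seq p q => p.LoopFree ∧ q.LoopFree
  | .ifLt _ _ p q => p.LoopFree ∧ q.LoopFree
  | .whileLt _ _ _ => False

/-- The final memory of a program without loops. -/
def Program.eval : Program → State → State
  | .skip, σ => σ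
  | .assign r e, σ => { reg := Function.update σ.reg r (e.eval σ), arr := σ.arr }
  | .store a i e, σ =>
    { reg := σ.reg
      arr := Function.update σ.arr a (Function.update (σ.arr a) (i.eval σ) (e.eval σ)) }
  | .seq p q, σ => q.eval (p.eval σ)
  | .ifLt e₁ e₂ p q, σ => if e₁.eval σ < e₂.eval σ then p.eval σ else q.eval σ
  | .whileLt _ _ _, σ => σ

/-- A bound on the running time of a program without loops. -/
def Program.bound : Program → ℕ
  | .skip => 1
  | .assign _ e => e.time + 1
  | .store _ i e => i.time + e.time + 1
  | .seq p q => p.bound + q.bound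
  | .ifLt e₁ e₂ p q => e₁.time + e₂.time + 1 + (p.bound + q.bound)
  | .whileLt _ _ _ => 0

/-- Straight-line code can thus be run by unfolding `Program.eval`; only loops need invariants. -/
theorem exec_eval : ∀ (p : Program) (σ : State), p.LoopFree →
    ∃ T ≤ p.bound, Exec p σ T (p.eval σ)
  | .skip, σ, _ => ⟨_, le_rfl, .skip σ⟩
  | .assign r e, σ, _ => ⟨_, le_rfl, .assign r e σ⟩
  | .store a i e, σ, _ => ⟨_, le_rfl, .store a i e σ⟩
  | .seq p q, σ, h => by
    obtain ⟨T₁, h1, h2⟩ := exec_eval p σ h.1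
    obtain ⟨T₂, h3, h4⟩ := exec_eval q (p.eval σ) h.2
    exact ⟨_, add_le_add h1 h3, .seq h2 h4⟩
  | .ifLt e₁ e₂ p q, σ, h => by
    by_cases hlt : e₁.eval σ < e₂.eval σ
    · obtain ⟨T, h1, h2⟩ := exec_eval p σ h.1
      refine ⟨_, ?_, by simpa [Program.eval, hlt] using Exec.ifTrue hlt h2⟩
      simp only [Program.bound]
      omega
    · obtain ⟨T, h1, h2⟩ := exec_eval q σ h.2
      refine ⟨_, ?_, by simpa only [Program.eval, if_neg hlt] using Exec.ifFalse hlt h2⟩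
      simp only [Program.bound]
      omega

/-- The rule for loops with a loop-free body: `P` is an invariant, which relates the memory to an
abstract configuration, and `φ` decreases. -/
theorem exec_while {α : Type*} {e₁ e₂ : Expr} {body : Program} (hb : body.LoopFree)
    {P : State → α → Prop} {φ : α → ℕ}
    (hstep : ∀ σ c, P σ c → e₁.eval σ < e₂.eval σ → ∃ c', P (body.eval σ) c' ∧ φ c' < φ c)
    {σ : State} {c : α} (h : P σ c) :
    ∃ T σ' c', Exec (.whileLt e₁ e₂ body) σ T σ' ∧ P σ' c' ∧ ¬ e₁.eval σ' < e₂.eval σ' ∧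
      T ≤ (body.bound + (e₁.time + e₂.time + 1)) * (φ c + 1) := by
  induction hk : φ c using Nat.strong_induction_on generalizing σ c with
  | _ k ih =>
    by_cases hlt : e₁.eval σ < e₂.eval σ
    · obtain ⟨c', h1, h2⟩ := hstep σ c h hlt
      obtain ⟨T₁, h3, h4⟩ := exec_eval body σ hb
      obtain ⟨T₂, σ', c'', h5, h6, h7, h8⟩ := ih (φ c') (hk ▸ h2) h1 rfl
      refine ⟨_, σ', c'', .whileTrue hlt h4 h5, h6, h7, ?_⟩
      have h9 : φ c' + 1 + 1 ≤ k + 1 := by omega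
      have h10 := Nat.mul_le_mul_left (body.bound + (e₁.time + e₂.time + 1)) h9
      rw [Nat.mul_succ] at h10
      omega
    · exact ⟨_, σ, c, .whileFalse hlt, h, hlt, by
        have := Nat.le_mul_of_pos_right (body.bound + (e₁.time + e₂.time + 1)) k.succ_pos
        simp only [Nat.succ_eq_add_one] at this
        omega⟩

/-- Run `body` with register `r` counting up from `0` to the number in register `1`. -/
def forLoop (r : ℕ) (body : Program) : Program :=
  .seq (.assign r (.const 0))
    (.whileLt (.reg r) (.reg 1) (.seq body (.assign r (.add (.reg r) (.const 1)))))

theorem exec_forLoop {r N : ℕ} {body : Program} (hb : body.LoopFree) {I : ℕ → State → Prop}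
    {σ : State} (hI : ∀ k σ, I k σ → σ.reg r = k ∧ σ.reg 1 = N)
    (h0 : I 0 ⟨Function.update σ.reg r 0, σ.arr⟩)
    (hstep : ∀ k σ, k < N → I k σ → I (k + 1)
      ⟨Function.update (body.eval σ).reg r ((body.eval σ).reg r + 1), (body.eval σ).arr⟩) :
    ∃ T σ', Exec (forLoop r body) σ T σ' ∧ I N σ' ∧ T ≤ (body.bound + 9) * (N + 1) := by
  obtain ⟨T, σ', k, h1, ⟨h2, h3⟩, h4, h5⟩ := exec_while (e₁ := .reg r) (e₂ := .reg 1)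
    (body := .seq body (.assign r (.add (.reg r) (.const 1)))) ⟨hb, trivial⟩
    (P := fun σ k => k ≤ N ∧ I k σ) (φ := fun k => N - k)
    (by
      rintro σ k ⟨hk, h⟩ hlt
      obtain ⟨h1, h2⟩ := hI k σ h
      have hkN : k < N := by
        simp only [Expr.eval] at hlt
        omega
      refine ⟨k + 1, ⟨hkN, ?_⟩, by omega⟩
      simpa only [Program.eval, Expr.eval] using hstep k σ hkN h)
    (σ := ⟨Function.update σ.reg r 0, σ.arr⟩) (c := 0) ⟨Nat.zero_le _, h0⟩
  have hkN : k = N := by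
    obtain ⟨h6, h7⟩ := hI k σ' h3
    simp only [Expr.eval, h6, h7] at h4
    omega
  refine ⟨_, σ', .seq (.assign r _ σ) h1, hkN ▸ h3, ?_⟩
  simp only [Program.bound, Expr.time, Nat.sub_zero] at h5 ⊢
  nlinarith

end Machine

/-! ### The search routine -/

section SearchProgram

/-- The list `l` is stored in the array `x` from position `lo` on. -/
def ListAt (x : ℤ → ℤ) : ℤ → List ℤ → Prop
  | _, [] => True
  | lo, v :: l => x lo = v ∧ ListAt x (lo + 1) l

theorem ListAt.update {x : ℤ → ℤ} {p v : ℤ} : ∀ {l : List ℤ} {lo : ℤ}, ListAt x lo l → p < lo →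
    ListAt (Function.update x p v) lo l
  | [], _, _, _ => trivial
  | _ :: _, _, h, hp => ⟨by rw [Function.update_of_ne hp.ne', h.1], h.2.update (by omega)⟩

theorem ListAt.push {x : ℤ → ℤ} {v lo : ℤ} {l : List ℤ} (h : ListAt x lo l) :
    ListAt (Function.update x (lo - 1) v) (lo - 1) (v :: l) :=
  ⟨by simp, by rw [sub_add_cancel]; exact h.update (by omega)⟩

/-- The linked list that starts at position `e` contains the entries `l`; the element at position
`e` has the entry `dst (e - 1)` and the successor `next e`, and `0` is the end. -/
def Linked (next dst : ℤ → ℤ) (M : ℤ) : ℤ → List ℤ → Prop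
  | e, [] => e = 0
  | e, w :: l => 0 < e ∧ e ≤ M ∧ dst (e - 1) = w ∧ Linked next dst M (next e) l

theorem Linked.update {next dst : ℤ → ℤ} {M v : ℤ} : ∀ {l : List ℤ} {e : ℤ},
    Linked next dst M e l → Linked (Function.update next (M + 1) v) dst (M + 1) e l
  | [], _, h => h
  | _ :: _, e, ⟨h1, h2, h3, h4⟩ =>
    ⟨h1, by omega, h3, by rw [Function.update_of_ne (by omega)]; exact h4.update⟩

/-- There is an arc from `u` to `w` in the graph whose `m` arcs have their ends in the arrays `src`
and `dst`. -/
def ArrayArc (src dst : ℤ → ℤ) (m : ℕ) (u w : ℤ) : Prop :=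
  ∃ p : ℕ, p < m ∧ src p = u ∧ dst p = w

theorem sum_length_update_cons {V : Finset ℤ} {adj : ℤ → List ℤ} {u w : ℤ} :
    ∑ v ∈ V, (Function.update adj u (w :: adj u) v).length ≤ ∑ v ∈ V, (adj v).length + 1 := by
  have h : ∀ v ∈ V, (Function.update adj u (w :: adj u) v).length =
      (adj v).length + if v = u then 1 else 0 := by
    intro v _
    rcases eq_or_ne v u with rfl | hv
    · simp
    · simp [hv]
  rw [Finset.sum_congr rfl h, Finset.sum_add_distrib, Finset.sum_ite_eq']
  split_ifs <;> omega

theorem sum_length_update_tail {V : Finset ℤ} {adj : ℤ → List ℤ} {u w : ℤ} {l : List ℤ}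
    (hu : u ∈ V) (h : adj u = w :: l) :
    ∑ v ∈ V, (Function.update adj u l v).length + 1 = ∑ v ∈ V, (adj v).length := by
  have h : ∀ v ∈ V, (adj v).length =
      (Function.update adj u l v).length + if v = u then 1 else 0 := by
    intro v _
    rcases eq_or_ne v u with rfl | hv
    · simp [h]
    · simp [hv]
  rw [Finset.sum_congr rfl h, Finset.sum_add_distrib, Finset.sum_ite_eq', if_pos hu]

/-- Add the arc in register `18` to the list of the arcs that leave its tail. -/
def link (b s : ℕ) : Program :=
  .seq (.store (b + 1) (.add (.reg 18) (.const 1)) (.arr b (.arr s (.reg 18))))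
    (.store b (.arr s (.reg 18)) (.add (.reg 18) (.const 1)))

/-- Visit the vertex in register `17` if it has not been found before. -/
def visit (b : ℕ) : Program :=
  .ifLt (.arr (b + 2) (.reg 17)) (.const 1)
    (.seq (.store (b + 2) (.reg 17) (.const 1))
      (.seq (.store (b + 3) (.reg 17) (.reg 14))
        (.seq (.assign 12 (.sub (.reg 12) (.const 1)))
          (.store (b + 4) (.reg 12) (.reg 17)))))
    .skip

/-- One step of a depth-first search. Registers `10` and `11` bound the roots that are left,
register `12` points to the top of the stack, register `13` to the vertex finished last, and
register `14` holds the current root. -/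
def searchStep (b t r : ℕ) : Program :=
  .ifLt (.reg 12) (.const 0)
    (.seq (.assign 15 (.arr (b + 4) (.reg 12)))
      (.seq (.assign 16 (.arr b (.reg 15)))
        (.ifLt (.const 0) (.reg 16)
          (.seq (.store b (.reg 15) (.arr (b + 1) (.reg 16)))
            (.seq (.assign 17 (.arr t (.sub (.reg 16) (.const 1)))) (visit b)))
          (.seq (.assign 13 (.sub (.reg 13) (.const 1)))
            (.seq (.store (b + 5) (.reg 13) (.reg 15))
              (.assign 12 (.add (.reg 12) (.const 1))))))))
    (.seq (.assign 17 (.arr r (.reg 10)))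
      (.seq (.assign 10 (.add (.reg 10) (.const 1)))
        (.seq (.assign 14 (.reg 17)) (visit b))))

/-- Depth-first search in the graph whose arcs have their ends in the arrays `s` and `t`, from the
roots in the array `r` between the positions `lo` and `hi`. It uses the arrays from `b` to `b + 5`:
the heads and the links of the lists of arcs, the flags and the roots of the vertices found, the
stack, and the vertices in the order of finishing, last finished first. -/
def search (b s t r : ℕ) (lo hi : Expr) : Program :=
  .seq (.assign 10 lo) (.seq (.assign 11 hi) (.seq (forLoop 18 (link b s))
    (.seq (.assign 12 (.const 0)) (.seq (.assign 13 (.const 0))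
      (.whileLt (.add (.reg 12) (.reg 10)) (.reg 11) (searchStep b t r))))))

/-- The memory while the lists of arcs are built. -/
structure LinkInv (σ₀ : State) (b s t : ℕ) (V : Finset ℤ) (k : ℕ) (σ : State)
    (adj : ℤ → List ℤ) : Prop where
  linked : ∀ u, Linked (σ.arr (b + 1)) (σ₀.arr t) k (σ.arr b u) (adj u)
  mem_adj : ∀ u w, w ∈ adj u ↔ ArrayArc (σ₀.arr s) (σ₀.arr t) k u w
  length : ∑ u ∈ V, (adj u).length ≤ k
  counter : σ.reg 18 = k
  arr_eq : ∀ a, a ≠ b → a ≠ b + 1 → σ.arr a = σ₀.arr a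
  reg_eq : ∀ r, r ≠ 18 → σ.reg r = σ₀.reg r

/-- Arc `k` occupies cell `k + 1`, because `0` marks the end of a list. Zeroed memory is then
already a family of empty lists, one for each integer. -/
theorem LinkInv.step {σ₀ σ : State} {b s t k : ℕ} {V : Finset ℤ} {adj : ℤ → List ℤ}
    (hs : s < b) (h : LinkInv σ₀ b s t V k σ adj) :
    LinkInv σ₀ b s t V (k + 1)
      ⟨Function.update ((link b s).eval σ).reg 18 (((link b s).eval σ).reg 18 + 1),
        ((link b s).eval σ).arr⟩
      (Function.update adj (σ₀.arr s k) (σ₀.arr t k :: adj (σ₀.arr s k))) := by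
  have hsb : s ≠ b + 1 := by omega
  have hs' : σ.arr s = σ₀.arr s := h.arr_eq s (by omega) (by omega)
  have heval : (link b s).eval σ = ⟨σ.reg, Function.update (Function.update σ.arr (b + 1)
      (Function.update (σ.arr (b + 1)) (k + 1) (σ.arr b (σ₀.arr s k)))) b
      (Function.update (σ.arr b) (σ₀.arr s k) (k + 1))⟩ := by
    simp [link, Program.eval, Expr.eval, h.counter, hs', hsb]
  rw [heval]
  constructor
  · intro u
    simp only [ne_eq, Nat.add_eq_left, one_ne_zero, not_false_eq_true, Function.update_of_ne,
      Function.update_self, Nat.cast_add, Nat.cast_one]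
    by_cases hu : u = σ₀.arr s k
    · subst hu
      simp only [Function.update_self]
      refine ⟨by omega, le_rfl, by simp, ?_⟩
      simp only [Function.update_self]
      exact (h.linked _).update
    · simp only [ne_eq, hu, not_false_eq_true, Function.update_of_ne]
      exact (h.linked u).update
  · intro u w
    have : ArrayArc (σ₀.arr s) (σ₀.arr t) (k + 1) u w ↔
        (σ₀.arr s k = u ∧ σ₀.arr t k = w) ∨ ArrayArc (σ₀.arr s) (σ₀.arr t) k u w := by
      simp only [ArrayArc, Nat.lt_succ_iff_lt_or_eq, or_and_right, exists_or, exists_eq_left]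
      exact or_comm
    rw [this, ← h.mem_adj]
    by_cases hu : u = σ₀.arr s k
    · subst hu
      simp [eq_comm]
    · simp [hu, Ne.symm hu]
  · exact sum_length_update_cons.trans (Nat.succ_le_succ h.length)
  · simp [h.counter]
  · intro a ha ha'
    simp [ha, ha', h.arr_eq a ha ha']
  · intro r hr
    simp [hr, h.reg_eq r hr]

/-- The memory during a depth-first search represents the configuration `c`. -/
structure SearchRep (σ₀ : State) (b t r m : ℕ) (σ : State) (c : Config) : Prop where
  linked : ∀ u, Linked (σ.arr (b + 1)) (σ₀.arr t) m (σ.arr b u) (c.adj u)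
  seen : ∀ v, c.Seen v → σ.arr (b + 2) v = 1
  unseen : ∀ v, ¬ c.Seen v → σ.arr (b + 2) v = 0
  lab : σ.arr (b + 3) = c.lab
  stack : ListAt (σ.arr (b + 4)) (σ.reg 12) c.stack
  stack_length : σ.reg 12 = -c.stack.length
  fin : ListAt (σ.arr (b + 5)) (σ.reg 13) c.fin
  fin_length : σ.reg 13 = -c.fin.length
  todo : ListAt (σ₀.arr r) (σ.reg 10) c.todo
  todo_length : σ.reg 10 + c.todo.length = σ.reg 11
  cur : c.stack ≠ [] → σ.reg 14 = c.cur
  arr_eq : ∀ a, a < b ∨ b + 6 ≤ a → σ.arr a = σ₀.arr a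
  reg_eq : ∀ r < 10, σ.reg r = σ₀.reg r

variable {σ₀ σ : State} {b t r m : ℕ} {c : Config}

/-- One of the five cases of a search step, each matching a lemma of `SearchInv`. In all of them
`heval` computes the new memory in closed form, and the fields are read off from it. -/
theorem SearchRep.pop (h : SearchRep σ₀ b t r m σ c) {u : ℤ} {s : List ℤ}
    (hs : c.stack = u :: s) (hu : c.adj u = []) :
    SearchRep σ₀ b t r m ((searchStep b t r).eval σ) { c with stack := s, fin := u :: c.fin } := by
  have hst := h.stack
  have hlen := h.stack_length
  rw [hs] at hst hlen
  simp only [List.length_cons, Nat.cast_add, Nat.cast_one] at hlen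
  have hneg : σ.reg 12 < 0 := by omega
  have hlink := h.linked u
  rw [hu] at hlink
  have heval : (searchStep b t r).eval σ = ⟨Function.update (Function.update (Function.update
      (Function.update σ.reg 15 u) 16 0) 13 (σ.reg 13 - 1)) 12 (σ.reg 12 + 1),
      Function.update σ.arr (b + 5) (Function.update (σ.arr (b + 5)) (σ.reg 13 - 1) u)⟩ := by
    simp [searchStep, Program.eval, Expr.eval, hneg, hst.1, show σ.arr b u = 0 from hlink]
  rw [heval]
  have hseen : ∀ v, Config.Seen { c with stack := s, fin := u :: c.fin } v ↔ c.Seen v := by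
    intro v
    simp only [Config.Seen, hs, List.mem_cons]
    tauto
  constructor
  · simpa using h.linked
  · simpa [hseen] using h.seen
  · simpa [hseen] using h.unseen
  · simpa using h.lab
  · simpa using hst.2
  · simp; omega
  · simpa using h.fin.push
  · simp [h.fin_length]; omega
  · simpa using h.todo
  · simpa using h.todo_length
  · simpa using fun _ => h.cur (by simp [hs])
  · intro a ha
    have : a ≠ b + 5 := by omega
    simpa [this] using h.arr_eq a ha
  · intro x hx
    have h1 : x ≠ 12 ∧ x ≠ 13 ∧ x ≠ 15 ∧ x ≠ 16 := by omega
    simpa [h1] using h.reg_eq x hx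

theorem SearchRep.skip (ht : t < b) (h : SearchRep σ₀ b t r m σ c) {u w : ℤ} {s l : List ℤ}
    (hs : c.stack = u :: s) (hu : c.adj u = w :: l) (hw : c.Seen w) :
    SearchRep σ₀ b t r m ((searchStep b t r).eval σ)
      { c with adj := Function.update c.adj u l } := by
  have hst := h.stack
  have hlen := h.stack_length
  rw [hs] at hst hlen
  simp only [List.length_cons, Nat.cast_add, Nat.cast_one] at hlen
  have hneg : σ.reg 12 < 0 := by omega
  have hlink := h.linked u
  rw [hu] at hlink
  obtain ⟨h1, -, h2, h3⟩ := hlink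
  rw [← h.arr_eq t (.inl ht)] at h2
  have htb : t ≠ b := ht.ne
  have heval : (searchStep b t r).eval σ = ⟨Function.update (Function.update (Function.update
      σ.reg 15 u) 16 (σ.arr b u)) 17 w,
      Function.update σ.arr b (Function.update (σ.arr b) u (σ.arr (b + 1) (σ.arr b u)))⟩ := by
    simp [searchStep, visit, Program.eval, Expr.eval, hneg, hst.1, h1, htb, h2, h.seen w hw]
  rw [heval]
  constructor
  · intro v
    rcases eq_or_ne v u with rfl | hv
    · simpa using h3
    · simpa [hv] using h.linked v
  · simpa [Config.Seen] using h.seen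
  · simpa [Config.Seen] using h.unseen
  · simpa using h.lab
  · simpa using h.stack
  · simpa using h.stack_length
  · simpa using h.fin
  · simpa using h.fin_length
  · simpa using h.todo
  · simpa using h.todo_length
  · simpa using h.cur
  · intro a ha
    have : a ≠ b := by omega
    simpa [this] using h.arr_eq a ha
  · intro x hx
    have h1 : x ≠ 15 ∧ x ≠ 16 ∧ x ≠ 17 := by omega
    simpa [h1] using h.reg_eq x hx

theorem SearchRep.push_of_adj (ht : t < b) (h : SearchRep σ₀ b t r m σ c) {u w : ℤ}
    {s l : List ℤ} (hs : c.stack = u :: s) (hu : c.adj u = w :: l) (hw : ¬ c.Seen w) :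
    SearchRep σ₀ b t r m ((searchStep b t r).eval σ) { c with
      adj := Function.update c.adj u l
      stack := w :: c.stack
      lab := Function.update c.lab w c.cur } := by
  have hst := h.stack
  have hlen := h.stack_length
  rw [hs] at hst hlen
  simp only [List.length_cons, Nat.cast_add, Nat.cast_one] at hlen
  have hneg : σ.reg 12 < 0 := by omega
  have hlink := h.linked u
  rw [hu] at hlink
  obtain ⟨h1, -, h2, h3⟩ := hlink
  rw [← h.arr_eq t (.inl ht)] at h2
  have htb : t ≠ b := ht.ne
  have hcur := h.cur (by simp [hs])
  have heval : (searchStep b t r).eval σ = ⟨Function.update (Function.update (Function.update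
      (Function.update σ.reg 15 u) 16 (σ.arr b u)) 17 w) 12 (σ.reg 12 - 1),
      Function.update (Function.update (Function.update (Function.update σ.arr
        b (Function.update (σ.arr b) u (σ.arr (b + 1) (σ.arr b u))))
        (b + 2) (Function.update (σ.arr (b + 2)) w 1))
        (b + 3) (Function.update (σ.arr (b + 3)) w c.cur))
        (b + 4) (Function.update (σ.arr (b + 4)) (σ.reg 12 - 1) w)⟩ := by
    simp [searchStep, visit, Program.eval, Expr.eval, hneg, hst.1, h1, htb, h2, h.unseen w hw,
      hcur]
  rw [heval]
  have hseen : ∀ (a : ℤ → List ℤ) (b : ℤ → ℤ) (v : ℤ), Config.Seen { c with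
      adj := a, stack := w :: c.stack, lab := b } v ↔ v = w ∨ c.Seen v := by
    intro a b v
    simp only [Config.Seen, List.mem_cons]
    tauto
  constructor
  · intro v
    rcases eq_or_ne v u with rfl | hv
    · simpa using h3
    · simpa [hv] using h.linked v
  · intro v hv
    rw [hseen] at hv
    rcases eq_or_ne v w with rfl | hvw
    · simp
    · simpa [hvw] using h.seen v (hv.resolve_left hvw)
  · intro v hv
    rw [hseen, not_or] at hv
    simpa [hv.1] using h.unseen v hv.2
  · simp [h.lab]
  · simpa using h.stack.push
  · simp [h.stack_length]; omega
  · simpa using h.fin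
  · simpa using h.fin_length
  · simpa using h.todo
  · simpa using h.todo_length
  · simpa using hcur
  · intro a ha
    have : a ≠ b ∧ a ≠ b + 2 ∧ a ≠ b + 3 ∧ a ≠ b + 4 := by omega
    simpa [this] using h.arr_eq a ha
  · intro x hx
    have h1 : x ≠ 15 ∧ x ≠ 16 ∧ x ≠ 17 ∧ x ≠ 12 := by omega
    simpa [h1] using h.reg_eq x hx

theorem SearchRep.skip_root (hr : r < b) (h : SearchRep σ₀ b t r m σ c) {v : ℤ} {l : List ℤ}
    (hs : c.stack = []) (hl : c.todo = v :: l) (hv : c.Seen v) :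
    SearchRep σ₀ b t r m ((searchStep b t r).eval σ)
      { c with old := c.old ++ [v], todo := l, cur := v } := by
  have hlen := h.stack_length
  have htodo := h.todo
  have htlen := h.todo_length
  rw [hl] at htodo htlen
  simp only [List.length_cons, Nat.cast_add, Nat.cast_one] at htlen
  simp only [hs, List.length_nil, Nat.cast_zero, neg_zero] at hlen
  have hroot : σ.arr r (σ.reg 10) = v := by rw [h.arr_eq r (.inl hr), htodo.1]
  have heval : (searchStep b t r).eval σ = ⟨Function.update (Function.update (Function.update
      σ.reg 17 v) 10 (σ.reg 10 + 1)) 14 v, σ.arr⟩ := by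
    simp [searchStep, visit, Program.eval, Expr.eval, hlen, hroot, h.seen v hv]
  rw [heval]
  constructor
  · simpa using h.linked
  · simpa [Config.Seen] using h.seen
  · simpa [Config.Seen] using h.unseen
  · simpa using h.lab
  · simpa using h.stack
  · simpa using h.stack_length
  · simpa using h.fin
  · simpa using h.fin_length
  · simpa using htodo.2
  · simp; omega
  · simp
  · simpa using h.arr_eq
  · intro x hx
    have h1 : x ≠ 17 ∧ x ≠ 10 ∧ x ≠ 14 := by omega
    simpa [h1] using h.reg_eq x hx

theorem SearchRep.push_root (hr : r < b) (h : SearchRep σ₀ b t r m σ c) {v : ℤ} {l : List ℤ}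
    (hs : c.stack = []) (hl : c.todo = v :: l) (hv : ¬ c.Seen v) :
    SearchRep σ₀ b t r m ((searchStep b t r).eval σ) { c with
      old := c.old ++ [v]
      todo := l
      cur := v
      stack := v :: c.stack
      lab := Function.update c.lab v v } := by
  have hlen := h.stack_length
  have htodo := h.todo
  have htlen := h.todo_length
  rw [hl] at htodo htlen
  simp only [List.length_cons, Nat.cast_add, Nat.cast_one] at htlen
  simp only [hs, List.length_nil, Nat.cast_zero, neg_zero] at hlen
  have hroot : σ.arr r (σ.reg 10) = v := by rw [h.arr_eq r (.inl hr), htodo.1]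
  have heval : (searchStep b t r).eval σ = ⟨Function.update (Function.update (Function.update
      (Function.update σ.reg 17 v) 10 (σ.reg 10 + 1)) 14 v) 12 (-1),
      Function.update (Function.update (Function.update σ.arr
        (b + 2) (Function.update (σ.arr (b + 2)) v 1))
        (b + 3) (Function.update (σ.arr (b + 3)) v v))
        (b + 4) (Function.update (σ.arr (b + 4)) (-1) v)⟩ := by
    simp [searchStep, visit, Program.eval, Expr.eval, hlen, hroot, h.unseen v hv]
  rw [heval]
  have hseen : ∀ a d (e : ℤ → ℤ) f (x : ℤ), Config.Seen { c with
      old := a, todo := d, cur := f, stack := v :: c.stack, lab := e } x ↔ x = v ∨ c.Seen x := by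
    intro a d e f x
    simp only [Config.Seen, List.mem_cons]
    tauto
  constructor
  · simpa using h.linked
  · intro x hx
    rw [hseen] at hx
    rcases eq_or_ne x v with rfl | hxv
    · simp
    · simpa [hxv] using h.seen x (hx.resolve_left hxv)
  · intro x hx
    rw [hseen, not_or] at hx
    simpa [hx.1] using h.unseen x hx.2
  · simp [h.lab]
  · simp [hs, ListAt]
  · simp [hs]
  · simpa using h.fin
  · simpa using h.fin_length
  · simpa using htodo.2
  · simp; omega
  · simp
  · intro a ha
    have : a ≠ b + 2 ∧ a ≠ b + 3 ∧ a ≠ b + 4 := by omega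
    simpa [this] using h.arr_eq a ha
  · intro x hx
    have h1 : x ≠ 17 ∧ x ≠ 10 ∧ x ≠ 14 ∧ x ≠ 12 := by omega
    simpa [h1] using h.reg_eq x hx

/-- One step of the search preserves the invariants and makes progress. -/
theorem SearchRep.step {E : ℤ → ℤ → Prop} {R : List ℤ} {V : Finset ℤ} {N : ℕ} (ht : t < b)
    (hr : r < b) (hV : ∀ u w, E u w → u ∈ V) (h : SearchRep σ₀ b t r m σ c)
    (hinv : SearchInv E R c) (hN : c.fin.length + c.stack.length + c.work V ≤ N)
    (hlt : σ.reg 12 + σ.reg 10 < σ.reg 11) :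
    ∃ c', (SearchRep σ₀ b t r m ((searchStep b t r).eval σ) c' ∧ SearchInv E R c' ∧
      c'.fin.length + c'.stack.length + c'.work V ≤ N) ∧
      2 * c'.work V + c'.stack.length < 2 * c.work V + c.stack.length := by
  -- A push consumes a root or an arc and lengthens the stack by one, while a pop only shortens the
  -- stack; the weight `2` on the work makes both decrease the potential. The bound by `N` limits
  -- the length of the finishing list.
  rcases hs : c.stack with _ | ⟨u, s⟩
  · rcases hl : c.todo with _ | ⟨v, l⟩
    · have h1 := h.stack_length
      have h2 := h.todo_length
      simp only [hs, hl, List.length_nil, Nat.cast_zero, neg_zero, add_zero] at h1 h2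
      omega
    · by_cases hv : c.Seen v
      · refine ⟨_, ⟨h.skip_root hr hs hl hv, hinv.skip_root hs hl hv, ?_⟩, ?_⟩ <;>
        · simp only [Config.work, hl, hs, List.length_cons, List.length_nil] at hN ⊢
          omega
      · refine ⟨_, ⟨h.push_root hr hs hl hv, hinv.push_root hs hl hv, ?_⟩, ?_⟩ <;>
        · simp only [Config.work, hl, hs, List.length_cons, List.length_nil] at hN ⊢
          omega
  · rcases hu : c.adj u with _ | ⟨w, l⟩
    · refine ⟨_, ⟨h.pop hs hu, hinv.pop hs hu, ?_⟩, ?_⟩ <;>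
      · simp only [Config.work, hs, List.length_cons] at hN ⊢
        omega
    · have huV : u ∈ V := hV u w (hinv.adj_sub u w (by simp [hu]))
      have hsum := sum_length_update_tail huV hu
      by_cases hw : c.Seen w
      · refine ⟨_, ⟨h.skip ht hs hu hw, hinv.skip hu (.inl (by simp [hs])) hw, ?_⟩, ?_⟩ <;>
        · simp only [Config.work, hs, List.length_cons] at hN ⊢
          omega
      · refine ⟨_, ⟨h.push_of_adj ht hs hu hw, hinv.push_of_adj hs hu hw, ?_⟩, ?_⟩ <;>
        · simp only [Config.work, hs, List.length_cons] at hN ⊢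
          omega

/-- The memory after a search. -/
structure SearchPost (σ₀ : State) (b s t m : ℕ) (R : List ℤ) (σ : State) (F : List ℤ) :
    Prop where
  result : SearchResult (ArrayArc (σ₀.arr s) (σ₀.arr t) m) R F (σ.arr (b + 3))
  seen : ∀ v ∈ F, σ.arr (b + 2) v = 1
  unseen : ∀ v ∉ F, σ.arr (b + 2) v = 0
  fin : ListAt (σ.arr (b + 5)) (σ.reg 13) F
  fin_length : σ.reg 13 = -F.length
  length_le : F.length ≤ m + R.length
  arr_eq : ∀ a, a < b ∨ b + 6 ≤ a → σ.arr a = σ₀.arr a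
  reg_eq : ∀ r < 10, σ.reg r = σ₀.reg r

/-- The six work arrays must be zero at the start, so each call uses a fresh block. The expression
`hi` is evaluated after register `10` has been overwritten, hence the form of `hhi`. -/
theorem exec_search {s : ℕ} {lo hi : Expr} {R : List ℤ} (hs : s < b) (ht : t < b) (hr : r < b)
    (hm : σ₀.reg 1 = m) (hz : ∀ a, b ≤ a → a < b + 6 → σ₀.arr a = 0)
    (hR : ListAt (σ₀.arr r) (lo.eval σ₀) R)
    (hhi : hi.eval ⟨Function.update σ₀.reg 10 (lo.eval σ₀), σ₀.arr⟩ = lo.eval σ₀ + R.length) :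
    ∃ T σ F, Exec (search b s t r lo hi) σ₀ T σ ∧ SearchPost σ₀ b s t m R σ F ∧
      T ≤ lo.time + hi.time + 300 * (m + R.length + 1) := by
  set E := ArrayArc (σ₀.arr s) (σ₀.arr t) m with hE
  set V : Finset ℤ := (Finset.range m).image fun p : ℕ => σ₀.arr s (p : ℤ) with hVdef
  have hV : ∀ u w, E u w → u ∈ V := by
    rintro u w ⟨p, hp, rfl, -⟩
    exact Finset.mem_image_of_mem _ (Finset.mem_range.2 hp)
  set σ₁ : State := ⟨Function.update (Function.update σ₀.reg 10 (lo.eval σ₀)) 11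
    (lo.eval σ₀ + R.length), σ₀.arr⟩ with hσ₁
  obtain ⟨T₁, σ₂, hex₁, ⟨adj, hlink⟩, hT₁⟩ := exec_forLoop (r := 18) (N := m) (body := link b s)
    ⟨trivial, trivial⟩ (I := fun k σ => ∃ adj, LinkInv σ₁ b s t V k σ adj) (σ := σ₁)
    (by
      rintro k σ ⟨adj, h⟩
      exact ⟨h.counter, by rw [h.reg_eq 1 (by norm_num)]; simpa [hσ₁] using hm⟩)
    (by
      refine ⟨fun _ => [], fun u => ?_, fun u w => ?_, ?_, ?_, ?_, ?_⟩
      · simp [Linked, hσ₁, hz b le_rfl (by omega)]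
      · simp [ArrayArc]
      · simp
      · simp
      · simp
      · intro r hr
        simp [hr])
    (by
      rintro k σ _ ⟨adj, h⟩
      exact ⟨_, h.step hs⟩)
  set σ₃ : State := ⟨Function.update (Function.update σ₂.reg 12 0) 13 0, σ₂.arr⟩ with hσ₃
  have harr : ∀ a, a ≠ b → a ≠ b + 1 → σ₂.arr a = σ₀.arr a := hlink.arr_eq
  have hrep : SearchRep σ₀ b t r m σ₃ ⟨[], R, [], [], adj, σ₂.arr (b + 3), 0⟩ := by
    constructor
    · exact hlink.linked
    · simp [Config.Seen]
    · intro v _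
      simp [hσ₃, harr (b + 2) (by omega) (by omega), hz (b + 2) (by omega) (by omega)]
    · rfl
    · trivial
    · simp [hσ₃]
    · trivial
    · simp [hσ₃]
    · simpa [hσ₃, hlink.reg_eq 10, hσ₁] using hR
    · simp [hσ₃, hlink.reg_eq 10, hlink.reg_eq 11, hσ₁]
    · simp
    · exact fun a ha => harr a (by omega) (by omega)
    · intro x hx
      have h1 : x ≠ 18 ∧ x ≠ 10 ∧ x ≠ 11 ∧ x ≠ 12 ∧ x ≠ 13 := by omega
      simp [hσ₃, h1, hlink.reg_eq x h1.1, hσ₁]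
  have hlen : ∑ u ∈ V, (adj u).length ≤ m := hlink.length
  obtain ⟨T₂, σ, c, hex₂, ⟨hrep', hinv, hN⟩, hdone, hT₂⟩ := exec_while
    (e₁ := .add (.reg 12) (.reg 10)) (e₂ := .reg 11) (body := searchStep b t r)
    (by simp [searchStep, visit, Program.LoopFree])
    (P := fun σ c => SearchRep σ₀ b t r m σ c ∧ SearchInv E R c ∧
      c.fin.length + c.stack.length + c.work V ≤ m + R.length)
    (φ := fun c => 2 * c.work V + c.stack.length)
    (fun σ c ⟨h1, h2, h3⟩ hlt => h1.step ht hr hV h2 h3 hlt)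
    ⟨hrep, .initial hlink.mem_adj _ _, by
      simp only [Config.work, List.length_nil]
      omega⟩
  -- Register `12` is minus the height of the stack, and register `11` minus register `10` is the
  -- number of roots left, so the single loop test fails only when both lists are empty.
  have hnil : c.stack = [] ∧ c.todo = [] := by
    have h1 := hrep'.stack_length
    have h2 := hrep'.todo_length
    simp only [Expr.eval] at hdone
    rw [← List.length_eq_zero_iff, ← List.length_eq_zero_iff]
    omega
  have hseen : ∀ v, c.Seen v ↔ v ∈ c.fin := by simp [Config.Seen, hnil.1]
  refine ⟨_, σ, c.fin, .seq (.assign 10 lo σ₀) (.seq (.assign 11 hi _) (.seq (?_ : Exec _ _ T₁ σ₂)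
    (.seq (.assign 12 (.const 0) _) (.seq (.assign 13 (.const 0) _) hex₂)))),
    ⟨?_, fun v hv => hrep'.seen v ((hseen v).2 hv), fun v hv => hrep'.unseen v (mt (hseen v).1 hv),
    hrep'.fin, hrep'.fin_length, by omega, hrep'.arr_eq, hrep'.reg_eq⟩, ?_⟩
  · rw [hhi]; exact hex₁
  · rw [hrep'.lab]; exact hinv.result hnil.1 hnil.2
  · have hb : (link b s).bound = 13 := rfl
    have hb' : (searchStep b t r).bound + ((Expr.add (.reg 12) (.reg 10)).time +
      (Expr.reg 11).time + 1) ≤ 100 := by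
      simp [searchStep, visit, Program.bound, Expr.time]
    rw [hb] at hT₁
    replace hT₂ := hT₂.trans (Nat.mul_le_mul_right _ hb')
    simp only [Config.work, List.length_nil, Expr.time] at hT₂ ⊢
    omega

end SearchProgram

/-! ### The filtering program -/

section Propagate

theorem listAt_concat {x : ℤ → ℤ} {v : ℤ} : ∀ {l : List ℤ} {lo : ℤ},
    ListAt x lo (l ++ [v]) ↔ ListAt x lo l ∧ x (lo + l.length) = v
  | [], lo => by simp [ListAt]
  | y :: l, lo => by
    simp only [List.cons_append, ListAt, listAt_concat, List.length_cons, and_assoc,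
      Nat.cast_add, Nat.cast_one]
    rw [show lo + 1 + (l.length : ℤ) = lo + (l.length + 1) by ring]

theorem ListAt.update_of_le {x : ℤ → ℤ} {p v : ℤ} : ∀ {l : List ℤ} {lo : ℤ}, ListAt x lo l →
    lo + l.length ≤ p → ListAt (Function.update x p v) lo l
  | [], _, _, _ => trivial
  | _ :: l, lo, h, hp => by
    simp only [List.length_cons, Nat.cast_add, Nat.cast_one] at hp
    exact ⟨by rw [Function.update_of_ne (by omega), h.1], h.2.update_of_le (by omega)⟩

theorem ListAt.concat {x : ℤ → ℤ} {v lo : ℤ} {l : List ℤ} (h : ListAt x lo l) :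
    ListAt (Function.update x (lo + l.length) v) lo (l ++ [v]) :=
  listAt_concat.2 ⟨h.update_of_le le_rfl, by simp⟩

theorem listAt_map_range (x : ℤ → ℤ) (m : ℕ) :
    ListAt x 0 ((List.range m).map fun p : ℕ => x p) := by
  induction m with
  | zero => trivial
  | succ m ih =>
    rw [List.range_succ, List.map_append, List.map_singleton, listAt_concat]
    exact ⟨ih, by simp⟩

/-- Read the flow on the pair in register `5`: array `4` holds the values assigned to the
variables, array `5` the number of variables assigned to each value, and register `4` the cost. -/
def readFlow : Program :=
  .ifLt (.const 0) (.arr 2 (.reg 5))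
    (.seq (.store 4 (.arr 0 (.reg 5)) (.arr 1 (.reg 5)))
      (.seq (.assign 4 (.add (.reg 4) (.arr 5 (.arr 1 (.reg 5)))))
        (.store 5 (.arr 1 (.reg 5)) (.add (.arr 5 (.arr 1 (.reg 5))) (.const 1)))))
    .skip

/-- Write the move given by the pair in register `5` from array `6` to array `1`. Array `7` holds
the moves between values of equal counts, and a loop for every other move. Arrays `8` and `9` list
the sources and the targets of the moves to a smaller count, register `8` counts them. -/
def classify : Program :=
  .seq (.assign 6 (.arr 4 (.arr 0 (.reg 5))))
    (.seq (.assign 7 (.arr 1 (.reg 5)))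
      (.seq (.store 6 (.reg 5) (.reg 6))
        (.seq (.store 7 (.reg 5) (.reg 7))
          (.ifLt (.arr 5 (.reg 7)) (.arr 5 (.reg 6))
            (.seq (.store 7 (.reg 5) (.reg 6))
              (.seq (.store 8 (.reg 8) (.reg 6))
                (.seq (.store 9 (.reg 8) (.reg 7)) (.assign 8 (.add (.reg 8) (.const 1))))))
            (.ifLt (.arr 5 (.reg 6)) (.arr 5 (.reg 7)) (.store 7 (.reg 5) (.reg 6)) .skip)))))

/-- Decide whether the pair in register `5` stays: it does if its value and the value assigned to
its variable lie in the same component, or if the least cost of an assignment that contains it does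
not exceed the greatest value of the cost variable. -/
def decidePair : Program :=
  .seq (.store 3 (.reg 5) (.const 1))
    (.ifLt (.reg 3)
      (.add (.sub (.sub (.sub (.add (.reg 4) (.arr 5 (.arr 1 (.reg 5)))) (.arr 32 (.arr 1 (.reg 5))))
        (.arr 5 (.arr 6 (.reg 5)))) (.arr 42 (.arr 6 (.reg 5)))) (.const 1))
      (.ifLt (.arr 23 (.arr 1 (.reg 5))) (.arr 23 (.arr 6 (.reg 5)))
        (.store 3 (.reg 5) (.const 0))
        (.ifLt (.arr 23 (.arr 6 (.reg 5))) (.arr 23 (.arr 1 (.reg 5)))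
          (.store 3 (.reg 5) (.const 0)) .skip))
      .skip)

/-- The filtering algorithm. The first two searches find the strongly connected components of the
graph of moves; the last two find the values that reach a smaller count and those that are reached
from a greater count. -/
def propagate : Program :=
  .seq (forLoop 5 readFlow) (.seq (forLoop 5 classify)
    (.seq (search 10 6 1 1 (.const 0) (.reg 1)) (.seq (search 20 1 6 15 (.reg 13) (.const 0))
      (.seq (search 30 7 6 8 (.const 0) (.reg 8)) (.seq (search 40 6 7 9 (.const 0) (.reg 8))
        (forLoop 5 decidePair))))))

/-- The initial memory `σ₀` describes `m` pairs and an assignment `A`. -/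
structure IsInput (σ₀ : State) (m : ℕ) (A : ℤ → ℤ) : Prop where
  size : σ₀.reg 1 = m
  reg_zero : ∀ r, 4 ≤ r → σ₀.reg r = 0
  arr_zero : ∀ a, 3 ≤ a → σ₀.arr a = 0
  flow : ∀ p : ℕ, p < m → (0 < σ₀.arr 2 p ↔ σ₀.arr 1 p = A (σ₀.arr 0 p))
  assigned : ∀ p : ℕ, p < m → ∃ q : ℕ, q < m ∧ σ₀.arr 0 q = σ₀.arr 0 p ∧
    σ₀.arr 1 q = A (σ₀.arr 0 p)

/-- The number of variables assigned to `v` among the first `k` pairs. -/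
def pairCount (σ₀ : State) (A : ℤ → ℤ) (k : ℕ) (v : ℤ) : ℤ :=
  ∑ p ∈ Finset.range k, if σ₀.arr 1 p = A (σ₀.arr 0 p) ∧ σ₀.arr 1 p = v then 1 else 0

theorem pairCount_succ (σ₀ : State) (A : ℤ → ℤ) (k : ℕ) (v : ℤ) :
    pairCount σ₀ A (k + 1) v = pairCount σ₀ A k v +
      if σ₀.arr 1 k = A (σ₀.arr 0 k) ∧ σ₀.arr 1 k = v then 1 else 0 :=
  Finset.sum_range_succ _ _

/-- The memory while the flow is read. -/
structure ReadInv (σ₀ : State) (A : ℤ → ℤ) (S : Finset ℤ) (m k : ℕ) (σ : State) : Prop where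
  assigned : ∀ p : ℕ, p < k → σ₀.arr 1 p = A (σ₀.arr 0 p) →
    σ.arr 4 (σ₀.arr 0 p) = A (σ₀.arr 0 p)
  counts : σ.arr 5 = pairCount σ₀ A k
  cost : 2 * σ.reg 4 = ∑ v ∈ S, σ.arr 5 v * (σ.arr 5 v - 1)
  counter : σ.reg 5 = k
  arr_eq : ∀ a, a ≠ 4 → a ≠ 5 → σ.arr a = σ₀.arr a
  reg_eq : ∀ r, r ≠ 4 → r ≠ 5 → σ.reg r = σ₀.reg r

/-- A variable added to a value of count `c` creates `c` conflicts; this is what `readFlow` adds to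
register `4`. -/
theorem sum_update_mul_pred {S : Finset ℤ} {x : ℤ → ℤ} {d : ℤ} (hd : d ∈ S) :
    ∑ v ∈ S, Function.update x d (x d + 1) v * (Function.update x d (x d + 1) v - 1) =
      ∑ v ∈ S, x v * (x v - 1) + 2 * x d := by
  have h : ∀ v ∈ S, Function.update x d (x d + 1) v * (Function.update x d (x d + 1) v - 1) =
      x v * (x v - 1) + if v = d then 2 * x d else 0 := by
    intro v _
    rcases eq_or_ne v d with rfl | hv
    · simp; ring
    · simp [hv]
  rw [Finset.sum_congr rfl h, Finset.sum_add_distrib, Finset.sum_ite_eq', if_pos hd]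

variable {σ₀ σ : State} {A : ℤ → ℤ} {S : Finset ℤ} {m k : ℕ}

theorem ReadInv.step (h₀ : IsInput σ₀ m A) (hS : ∀ p : ℕ, p < m → σ₀.arr 1 p ∈ S) (hk : k < m)
    (h : ReadInv σ₀ A S m k σ) :
    ReadInv σ₀ A S m (k + 1) ⟨Function.update (readFlow.eval σ).reg 5
      ((readFlow.eval σ).reg 5 + 1), (readFlow.eval σ).arr⟩ := by
  have h0 := h.arr_eq 0 (by norm_num) (by norm_num)
  have h1 := h.arr_eq 1 (by norm_num) (by norm_num)
  have h2 := h.arr_eq 2 (by norm_num) (by norm_num)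
  have hc := h.counter
  by_cases hf : 0 < σ₀.arr 2 k
  · have hA := (h₀.flow k hk).1 hf
    have heval : readFlow.eval σ = ⟨Function.update σ.reg 4 (σ.reg 4 + σ.arr 5 (σ₀.arr 1 k)),
        Function.update (Function.update σ.arr 4
          (Function.update (σ.arr 4) (σ₀.arr 0 k) (σ₀.arr 1 k))) 5
          (Function.update (σ.arr 5) (σ₀.arr 1 k) (σ.arr 5 (σ₀.arr 1 k) + 1))⟩ := by
      simp [readFlow, Program.eval, Expr.eval, h0, h1, h2, hc, hf]
    rw [heval]
    constructor
    · intro p hp hpA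
      by_cases hpk : σ₀.arr 0 p = σ₀.arr 0 k
      · simp [hpk, hA]
      · have : p ≠ k := by rintro rfl; exact hpk rfl
        simpa [hpk] using h.assigned p (by omega) hpA
    · funext v
      rw [pairCount_succ, ← h.counts]
      by_cases hv : σ₀.arr 1 k = v
      · subst hv; simp [hA]
      · simp [hv, Ne.symm hv]
    · simp only [Function.update_self, ne_eq, Nat.reduceEqDiff,
        not_false_eq_true, Function.update_of_ne]
      rw [sum_update_mul_pred (hS k hk), ← h.cost]
      ring
    · simp [hc]
    · intro a h4 h5
      simp [h4, h5, h.arr_eq a h4 h5]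
    · intro r h4 h5
      simp [h4, h5, h.reg_eq r h4 h5]
  · have hA := mt (h₀.flow k hk).2 hf
    have heval : readFlow.eval σ = σ := by
      simp [readFlow, Program.eval, Expr.eval, h2, hc, hf]
    rw [heval]
    constructor
    · intro p hp hpA
      have : p ≠ k := by rintro rfl; exact hA hpA
      exact h.assigned p (by omega) hpA
    · funext v
      rw [pairCount_succ, ← h.counts]
      simp [hA]
    · simpa using h.cost
    · simp [hc]
    · exact h.arr_eq
    · intro r h4 h5
      simp [h5, h.reg_eq r h4 h5]

/-- The memory while the moves are classified; `c` are the counts. -/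
structure ClassifyInv (σ₁ : State) (A c : ℤ → ℤ) (k : ℕ) (σ : State) (up down : List ℤ) :
    Prop where
  src : ∀ p : ℕ, p < k → σ.arr 6 p = A (σ₁.arr 0 p)
  dst : ∀ p : ℕ, p < k → σ.arr 7 p =
    if c (σ₁.arr 1 p) = c (A (σ₁.arr 0 p)) then σ₁.arr 1 p else A (σ₁.arr 0 p)
  up_at : ListAt (σ.arr 8) 0 up
  down_at : ListAt (σ.arr 9) 0 down
  up_length : σ.reg 8 = up.length
  down_length : σ.reg 8 = down.length
  length_le : up.length ≤ k
  mem_up : ∀ u, u ∈ up ↔ ∃ p : ℕ, p < k ∧ A (σ₁.arr 0 p) = u ∧ c (σ₁.arr 1 p) < c u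
  mem_down : ∀ w, w ∈ down ↔ ∃ p : ℕ, p < k ∧ σ₁.arr 1 p = w ∧ c w < c (A (σ₁.arr 0 p))
  counter : σ.reg 5 = k
  arr_eq : ∀ a, a < 6 ∨ 9 < a → σ.arr a = σ₁.arr a
  reg_eq : ∀ r, r < 5 ∨ 8 < r → σ.reg r = σ₁.reg r

/-- Replacing a move between different counts by a loop, rather than deleting it, keeps one arc per
pair, so `search` runs on this graph with the same `m`. -/
theorem ClassifyInv.step {σ₁ : State} {c : ℤ → ℤ} {up down : List ℤ}
    (hA : σ₁.arr 4 (σ₁.arr 0 k) = A (σ₁.arr 0 k)) (hc : σ₁.arr 5 = c)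
    (h : ClassifyInv σ₁ A c k σ up down) :
    ∃ up' down', ClassifyInv σ₁ A c (k + 1) ⟨Function.update (classify.eval σ).reg 5
      ((classify.eval σ).reg 5 + 1), (classify.eval σ).arr⟩ up' down' := by
  have h0 := h.arr_eq 0 (by norm_num)
  have h1 := h.arr_eq 1 (by norm_num)
  have h4 := h.arr_eq 4 (by norm_num)
  have h5 := (h.arr_eq 5 (by norm_num)).trans hc
  have hk := h.counter
  set a := A (σ₁.arr 0 k) with ha
  set d := σ₁.arr 1 k with hd
  have hup : ∀ u, (∃ p : ℕ, p < k + 1 ∧ A (σ₁.arr 0 p) = u ∧ c (σ₁.arr 1 p) < c u) ↔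
      u ∈ up ∨ a = u ∧ c d < c u := by
    intro u
    simp only [h.mem_up, Nat.lt_succ_iff_lt_or_eq, or_and_right, exists_or, exists_eq_left, ha, hd]
  have hdown : ∀ w, (∃ p : ℕ, p < k + 1 ∧ σ₁.arr 1 p = w ∧ c w < c (A (σ₁.arr 0 p))) ↔
      w ∈ down ∨ d = w ∧ c w < c a := by
    intro w
    simp only [h.mem_down, Nat.lt_succ_iff_lt_or_eq, or_and_right, exists_or, exists_eq_left, ha, hd]
  by_cases hlt : c d < c a
  · have heval : classify.eval σ = ⟨Function.update (Function.update (Function.update σ.reg 6 a)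
        7 d) 8 (σ.reg 8 + 1), Function.update (Function.update (Function.update (Function.update
        σ.arr 6 (Function.update (σ.arr 6) k a)) 7 (Function.update (σ.arr 7) k a))
        8 (Function.update (σ.arr 8) (σ.reg 8) a)) 9 (Function.update (σ.arr 9) (σ.reg 8) d)⟩ := by
      simp [classify, Program.eval, Expr.eval, h0, h1, h4, h5, hk, hA, ← hd, hlt]
    rw [heval]
    refine ⟨up ++ [a], down ++ [d], ?_⟩
    constructor
    · intro p hp
      by_cases hpk : p = k
      · simp [hpk, ha]
      · simpa [hpk] using h.src p (by omega)
    · intro p hp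
      by_cases hpk : p = k
      · simp [hpk, ← ha, ← hd, hlt.ne]
      · simpa [hpk] using h.dst p (by omega)
    · simpa [h.up_length] using h.up_at.concat
    · simpa [h.down_length] using h.down_at.concat
    · simp [h.up_length]
    · simp [h.down_length]
    · simp [h.length_le]
    · intro u
      rw [hup, List.mem_append, List.mem_singleton]
      refine or_congr_right ⟨?_, fun h => h.1.symm⟩
      rintro rfl
      exact ⟨rfl, hlt⟩
    · intro w
      rw [hdown, List.mem_append, List.mem_singleton]
      refine or_congr_right ⟨?_, fun h => h.1.symm⟩
      rintro rfl
      exact ⟨rfl, hlt⟩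
    · simp [hk]
    · intro x hx
      have : x ≠ 6 ∧ x ≠ 7 ∧ x ≠ 8 ∧ x ≠ 9 := by omega
      simpa [this] using h.arr_eq x hx
    · intro x hx
      have : x ≠ 5 ∧ x ≠ 6 ∧ x ≠ 7 ∧ x ≠ 8 := by omega
      simpa [this] using h.reg_eq x hx
  · have heval : classify.eval σ = ⟨Function.update (Function.update σ.reg 6 a) 7 d,
        Function.update (Function.update σ.arr 6 (Function.update (σ.arr 6) k a)) 7
          (Function.update (σ.arr 7) k (if c d = c a then d else a))⟩ := by
      rcases eq_or_ne (c d) (c a) with heq | hne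
      · simp [classify, Program.eval, Expr.eval, h0, h1, h4, h5, hk, hA, ← hd, heq]
      · have hgt : c a < c d := by omega
        simp [classify, Program.eval, Expr.eval, h0, h1, h4, h5, hk, hA, ← hd, hlt, hgt, hne]
    rw [heval]
    refine ⟨up, down, ?_⟩
    constructor
    · intro p hp
      by_cases hpk : p = k
      · simp [hpk, ha]
      · simpa [hpk] using h.src p (by omega)
    · intro p hp
      by_cases hpk : p = k
      · simp [hpk, ← ha, ← hd]
      · simpa [hpk] using h.dst p (by omega)
    · simpa using h.up_at
    · simpa using h.down_at
    · simpa using h.up_length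
    · simpa using h.down_length
    · exact h.length_le.trans (Nat.le_succ k)
    · intro u
      rw [hup, or_iff_left]
      rintro ⟨rfl, hlt'⟩
      exact hlt hlt'
    · intro w
      rw [hdown, or_iff_left]
      rintro ⟨rfl, hlt'⟩
      exact hlt hlt'
    · simp [hk]
    · intro x hx
      have : x ≠ 6 ∧ x ≠ 7 := by omega
      simpa [this] using h.arr_eq x hx
    · intro x hx
      have : x ≠ 5 ∧ x ≠ 6 ∧ x ≠ 7 := by omega
      simpa [this] using h.reg_eq x hx

/-- The test that `decidePair` makes for the value `d` and the assigned value `a`. -/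
def Keeps (σ : State) (d a : ℤ) : Prop :=
  σ.arr 23 d = σ.arr 23 a ∨
    σ.reg 4 + (σ.arr 5 d - σ.arr 32 d) - (σ.arr 5 a + σ.arr 42 a) + 1 ≤ σ.reg 3

/-- The memory while the pairs are decided. -/
structure DecideInv (σ₁ : State) (k : ℕ) (σ : State) : Prop where
  keeps : ∀ p : ℕ, p < k → (σ.arr 3 p = 1 ↔ Keeps σ₁ (σ₁.arr 1 p) (σ₁.arr 6 p))
  counter : σ.reg 5 = k
  arr_eq : ∀ a, a ≠ 3 → σ.arr a = σ₁.arr a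
  reg_eq : ∀ r, r ≠ 5 → σ.reg r = σ₁.reg r

theorem DecideInv.step {σ₁ : State} (h : DecideInv σ₁ k σ) :
    DecideInv σ₁ (k + 1) ⟨Function.update (decidePair.eval σ).reg 5
      ((decidePair.eval σ).reg 5 + 1), (decidePair.eval σ).arr⟩ := by
  have hk := h.counter
  obtain ⟨x, hx, heval⟩ : ∃ x : ℤ, (x = 1 ↔ Keeps σ₁ (σ₁.arr 1 k) (σ₁.arr 6 k)) ∧
      decidePair.eval σ =
        ⟨σ.reg, Function.update σ.arr 3 (Function.update (σ.arr 3) k x)⟩ := by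
    have h1 := h.arr_eq 1 (by norm_num)
    have h5 := h.arr_eq 5 (by norm_num)
    have h6 := h.arr_eq 6 (by norm_num)
    have h23 := h.arr_eq 23 (by norm_num)
    have h32 := h.arr_eq 32 (by norm_num)
    have h42 := h.arr_eq 42 (by norm_num)
    have r3 := h.reg_eq 3 (by norm_num)
    have r4 := h.reg_eq 4 (by norm_num)
    unfold Keeps
    set d := σ₁.arr 1 k with hd
    set a := σ₁.arr 6 k with ha
    by_cases hB : σ₁.reg 3 <
        σ₁.reg 4 + σ₁.arr 5 d - σ₁.arr 32 d - σ₁.arr 5 a - σ₁.arr 42 a + 1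
    · rcases lt_trichotomy (σ₁.arr 23 d) (σ₁.arr 23 a) with hlt | heq | hgt
      · refine ⟨0, by omega, ?_⟩
        simp [decidePair, Program.eval, Expr.eval, hk, h1, h5, h6, h23, h32, h42, r3, r4, ← hd,
          ← ha, hB, hlt]
      · refine ⟨1, by omega, ?_⟩
        simp [decidePair, Program.eval, Expr.eval, hk, h1, h5, h6, h23, h32, h42, r3, r4, ← hd,
          ← ha, hB, heq]
      · refine ⟨0, by omega, ?_⟩
        simp [decidePair, Program.eval, Expr.eval, hk, h1, h5, h6, h23, h32, h42, r3, r4, ← hd,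
          ← ha, hB, hgt, hgt.not_gt]
    · refine ⟨1, by omega, ?_⟩
      simp [decidePair, Program.eval, Expr.eval, hk, h1, h5, h6, h32, h42, r3, r4, ← hd,
        ← ha, hB]
  rw [heval]
  constructor
  · intro p hp
    by_cases hpk : p = k
    · subst hpk
      simpa using hx
    · simpa [hpk] using h.keeps p (by omega)
  · simp [hk]
  · intro a ha
    simp [ha, h.arr_eq a ha]
  · intro r hr
    simp [hr, h.reg_eq r hr]

end Propagate

/-! ### Correctness and running time of the filtering algorithm -/

section Correctness

theorem ArrayArc.congr {x y x' y' : ℤ → ℤ} {m : ℕ} (hx : ∀ p : ℕ, p < m → x p = x' p)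
    (hy : ∀ p : ℕ, p < m → y p = y' p) : ArrayArc x y m = ArrayArc x' y' m := by
  funext u w
  refine propext (exists_congr fun p => and_congr_right fun hp => ?_)
  rw [hx p hp, hy p hp]

/-- A search of the reverse graph is the same routine with the two arrays exchanged. -/
theorem arrayArc_swap (x y : ℤ → ℤ) (m : ℕ) :
    ArrayArc y x m = fun u w => ArrayArc x y m w u := by
  funext u w
  exact propext (exists_congr fun p => and_congr_right fun _ => and_comm)

theorem exec_readFlow {σ₀ : State} {m : ℕ} {A : ℤ → ℤ} {S : Finset ℤ} (h₀ : IsInput σ₀ m A)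
    (hS : ∀ p : ℕ, p < m → σ₀.arr 1 p ∈ S) :
    ∃ T σ, Exec (forLoop 5 readFlow) σ₀ T σ ∧ ReadInv σ₀ A S m m σ ∧ T ≤ 100 * (m + 1) := by
  obtain ⟨T, σ, h1, h2, h3⟩ := exec_forLoop (r := 5) (N := m) (body := readFlow) (σ := σ₀)
    (by simp [readFlow, Program.LoopFree]) (I := ReadInv σ₀ A S m)
    (fun k σ h => ⟨h.counter, by rw [h.reg_eq 1 (by norm_num) (by norm_num), h₀.size]⟩)
    (by
      constructor
      · simp
      · funext v; simp [h₀.arr_zero 5 (by norm_num), pairCount]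
      · simp [h₀.arr_zero 5 (by norm_num), h₀.reg_zero 4 le_rfl]
      · simp
      · simp
      · intro r _ hr
        simp [hr])
    (fun k σ hk h => h.step h₀ hS hk)
  refine ⟨T, σ, h1, h2, h3.trans (Nat.mul_le_mul_right _ ?_)⟩
  simp [readFlow, Program.bound, Expr.time]

theorem exec_classify {σ₁ : State} {m : ℕ} {A c : ℤ → ℤ} (hm : σ₁.reg 1 = m)
    (hr : σ₁.reg 8 = 0) (hA : ∀ p : ℕ, p < m → σ₁.arr 4 (σ₁.arr 0 p) = A (σ₁.arr 0 p))
    (hc : σ₁.arr 5 = c) :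
    ∃ T σ up down, Exec (forLoop 5 classify) σ₁ T σ ∧ ClassifyInv σ₁ A c m σ up down ∧
      T ≤ 100 * (m + 1) := by
  obtain ⟨T, σ, h1, ⟨up, down, h2⟩, h3⟩ := exec_forLoop (r := 5) (N := m) (body := classify)
    (σ := σ₁) (by simp [classify, Program.LoopFree])
    (I := fun k σ => ∃ up down, ClassifyInv σ₁ A c k σ up down)
    (by
      rintro k σ ⟨up, down, h⟩
      exact ⟨h.counter, by rw [h.reg_eq 1 (by norm_num), hm]⟩)
    (by
      refine ⟨[], [], ?_⟩
      constructor
      · simp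
      · simp
      · trivial
      · trivial
      · simp [hr]
      · simp [hr]
      · simp
      · simp
      · simp
      · simp
      · simp
      · intro r hr
        have : r ≠ 5 := by omega
        simp [this])
    (by
      rintro k σ hk ⟨up, down, h⟩
      exact h.step (hA k hk) hc)
  refine ⟨T, σ, up, down, h1, h2, h3.trans (Nat.mul_le_mul_right _ ?_)⟩
  simp [classify, Program.bound, Expr.time]

theorem exec_decidePair {σ₁ : State} {m : ℕ} (hm : σ₁.reg 1 = m) :
    ∃ T σ, Exec (forLoop 5 decidePair) σ₁ T σ ∧ DecideInv σ₁ m σ ∧ T ≤ 100 * (m + 1) := by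
  obtain ⟨T, σ, h1, h2, h3⟩ := exec_forLoop (r := 5) (N := m) (body := decidePair)
    (σ := σ₁) (by simp [decidePair, Program.LoopFree]) (I := DecideInv σ₁)
    (fun k σ h => ⟨h.counter, by rw [h.reg_eq 1 (by norm_num), hm]⟩)
    (by
      constructor
      · simp
      · simp
      · simp
      · intro r hr
        simp [hr])
    (fun k σ _ h => h.step)
  refine ⟨T, σ, h1, h2, h3.trans (Nat.mul_le_mul_right _ ?_)⟩
  simp [decidePair, Program.bound, Expr.time]

/-- The filtering program computes the least violation and tests each pair. -/
theorem exec_propagate {n m : ℕ} {D : Fin n → Finset ℤ} {a : Fin n → ℤ} (hopt : IsOptimal D a)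
    {σ₀ : State} {A : ℤ → ℤ} (h₀ : IsInput σ₀ m A)
    (hmove : ∀ u w, Move D a u w ↔ ∃ p : ℕ, p < m ∧ A (σ₀.arr 0 p) = u ∧ σ₀.arr 1 p = w)
    (hcount : pairCount σ₀ A m = count a) :
    ∃ T σ, Exec propagate σ₀ T σ ∧ T ≤ 4000 * (m + 1) ∧ σ.reg 4 = violation a ∧
      ∀ p : ℕ, p < m → (σ.arr 3 p = 1 ↔ Reach D a (σ₀.arr 1 p) (A (σ₀.arr 0 p)) ∨
        (violation a : ℤ) + low D a (σ₀.arr 1 p) - high D a (A (σ₀.arr 0 p)) + 1 ≤ σ₀.reg 3) := by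
  have hval : ∀ p : ℕ, p < m → ∃ q : ℕ, q < m ∧ σ₀.arr 1 q = A (σ₀.arr 0 p) := by
    intro p hp
    obtain ⟨q, h1, -, h2⟩ := h₀.assigned p hp
    exact ⟨q, h1, h2⟩
  set S : Finset ℤ := (Finset.range m).image fun p : ℕ => σ₀.arr 1 (p : ℤ) with hSdef
  have hS : ∀ p : ℕ, p < m → σ₀.arr 1 p ∈ S := fun p hp =>
    Finset.mem_image_of_mem (fun p : ℕ => σ₀.arr 1 (p : ℤ)) (Finset.mem_range.2 hp)
  obtain ⟨T₁, σ₁, hex₁, h₁, hT₁⟩ := exec_readFlow h₀ hS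
  have h10 := h₁.arr_eq 0 (by norm_num) (by norm_num)
  have h11 := h₁.arr_eq 1 (by norm_num) (by norm_num)
  have hasg : ∀ p : ℕ, p < m → σ₁.arr 4 (σ₁.arr 0 p) = A (σ₁.arr 0 p) := by
    intro p hp
    obtain ⟨q, h1, h2, h3⟩ := h₀.assigned p hp
    have := h₁.assigned q h1 (by rw [h2, h3])
    rwa [h10, ← h2]
  obtain ⟨T₂, σ₂, up, down, hex₂, h₂, hT₂⟩ := exec_classify (A := A) (c := count a)
    (by rw [h₁.reg_eq 1 (by norm_num) (by norm_num), h₀.size])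
    (by rw [h₁.reg_eq 8 (by norm_num) (by norm_num), h₀.reg_zero 8 (by norm_num)]) hasg
    (by rw [h₁.counts, hcount])
  obtain ⟨hsrc, hdst, hup_at, hdown_at, hup_len, hdown_len, hup_le, hup, hdown, -, harr₂, hreg₂⟩ := h₂
  simp only [h10, h11] at hsrc hdst hup hdown
  have hzero : ∀ x, 10 ≤ x → σ₂.arr x = 0 := fun x hx => by
    rw [harr₂ x (by omega), h₁.arr_eq x (by omega) (by omega), h₀.arr_zero x (by omega)]
  have h21 : σ₂.arr 1 = σ₀.arr 1 := by rw [harr₂ 1 (by norm_num), h11]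
  have hreg1 : σ₂.reg 1 = m := by
    rw [hreg₂ 1 (by norm_num), h₁.reg_eq 1 (by norm_num) (by norm_num), h₀.size]
  obtain ⟨T₃, σ₃, F₁, hex₃, h₃, hT₃⟩ := exec_search (b := 10) (s := 6) (t := 1) (r := 1) (m := m)
    (σ₀ := σ₂) (lo := .const 0) (hi := .reg 1) (R := (List.range m).map fun p : ℕ => σ₀.arr 1 p)
    (by norm_num) (by norm_num) (by norm_num) hreg1 (fun x hx _ => hzero x hx)
    (by rw [h21]; exact listAt_map_range _ _) (by simp [Expr.eval, hreg1])
  -- Array `15` holds the finishing order of the first search at negative positions, from register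
  -- `13` up to `0`, already in the order that Kosaraju's second search needs.
  obtain ⟨T₄, σ₄, F₂, hex₄, h₄, hT₄⟩ := exec_search (b := 20) (s := 1) (t := 6) (r := 15) (m := m)
    (σ₀ := σ₃) (lo := .reg 13) (hi := .const 0) (R := F₁)
    (by norm_num) (by norm_num) (by norm_num) (by rw [h₃.reg_eq 1 (by norm_num), hreg1])
    (fun x hx _ => by rw [h₃.arr_eq x (by omega), hzero x (by omega)])
    h₃.fin (by simp [Expr.eval, h₃.fin_length])
  -- Backwards along equal counts from the sources of decreasing moves; the flags in array `32`
  -- become the correction in `low`. The next search goes forwards from the targets, and array `42`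
  -- gives the correction in `high`.
  obtain ⟨T₅, σ₅, F₃, hex₅, h₅, hT₅⟩ := exec_search (b := 30) (s := 7) (t := 6) (r := 8) (m := m)
    (σ₀ := σ₄) (lo := .const 0) (hi := .reg 8) (R := up)
    (by norm_num) (by norm_num) (by norm_num)
    (by rw [h₄.reg_eq 1 (by norm_num), h₃.reg_eq 1 (by norm_num), hreg1])
    (fun x hx _ => by rw [h₄.arr_eq x (by omega), h₃.arr_eq x (by omega), hzero x (by omega)])
    (by rw [h₄.arr_eq 8 (by omega), h₃.arr_eq 8 (by omega)]; exact hup_at)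
    (by simp [Expr.eval, h₄.reg_eq 8 (by norm_num), h₃.reg_eq 8 (by norm_num), hup_len])
  obtain ⟨T₆, σ₆, F₄, hex₆, h₆, hT₆⟩ := exec_search (b := 40) (s := 6) (t := 7) (r := 9) (m := m)
    (σ₀ := σ₅) (lo := .const 0) (hi := .reg 8) (R := down)
    (by norm_num) (by norm_num) (by norm_num)
    (by rw [h₅.reg_eq 1 (by norm_num), h₄.reg_eq 1 (by norm_num), h₃.reg_eq 1 (by norm_num), hreg1])
    (fun x hx _ => by
      rw [h₅.arr_eq x (by omega), h₄.arr_eq x (by omega), h₃.arr_eq x (by omega), hzero x (by omega)])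
    (by
      rw [h₅.arr_eq 9 (by omega), h₄.arr_eq 9 (by omega), h₃.arr_eq 9 (by omega)]
      exact hdown_at)
    (by simp [Expr.eval, h₅.reg_eq 8 (by norm_num), h₄.reg_eq 8 (by norm_num),
      h₃.reg_eq 8 (by norm_num), hdown_len])
  have hreg₆ : ∀ x < 5, x ≠ 4 → σ₆.reg x = σ₀.reg x := fun x hx hx4 => by
    rw [h₆.reg_eq x (by omega), h₅.reg_eq x (by omega), h₄.reg_eq x (by omega),
      h₃.reg_eq x (by omega), hreg₂ x (by omega), h₁.reg_eq x (by omega) (by omega)]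
  have harr₆ : ∀ x < 10, σ₆.arr x = σ₂.arr x := fun x hx => by
    rw [h₆.arr_eq x (by omega), h₅.arr_eq x (by omega), h₄.arr_eq x (by omega),
      h₃.arr_eq x (by omega)]
  obtain ⟨T₇, σ₇, hex₇, h₇, hT₇⟩ := exec_decidePair (σ₁ := σ₆) (m := m)
    (by rw [hreg₆ 1 (by norm_num) (by norm_num), h₀.size])
  have hmu : σ₆.reg 4 = violation a := by
    have h1 : σ₆.reg 4 = σ₁.reg 4 := by
      rw [h₆.reg_eq 4 (by omega), h₅.reg_eq 4 (by omega), h₄.reg_eq 4 (by omega),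
        h₃.reg_eq 4 (by omega), hreg₂ 4 (by omega)]
    have h2 := h₁.cost
    rw [h₁.counts, hcount, ← two_mul_violation a (S := S) fun i => ?_, ← h1] at h2
    · omega
    · obtain ⟨p, hp, -, h3⟩ := (hmove _ _).1 ⟨i, rfl, hopt.mem i⟩
      rw [← h3]
      exact hS p hp
  set E₀ := ArrayArc (σ₂.arr 6) (σ₂.arr 7) m with hE₀
  have hE : ArrayArc (σ₂.arr 6) (σ₂.arr 1) m = Move D a := by
    funext u w
    refine propext (Iff.trans (exists_congr fun p => and_congr_right fun hp => ?_) (hmove u w).symm)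
    rw [hsrc p hp, h21]
  -- `ReflGen` accounts for the loops that `classify` puts in place of moves between different
  -- counts.
  have hE₀1 : ∀ {u w}, E₀ u w → ReflGen (Move D a) u w ∧ count a u = count a w := by
    rintro u w ⟨p, hp, rfl, rfl⟩
    rw [hsrc p hp, hdst p hp]
    split_ifs with hif
    · exact ⟨.single ((hmove _ _).2 ⟨p, hp, rfl, rfl⟩), hif.symm⟩
    · exact ⟨.refl, rfl⟩
  have hE₀2 : ∀ {u w}, Move D a u w → count a u = count a w → E₀ u w := by
    intro u w huw hc
    obtain ⟨p, hp, rfl, rfl⟩ := (hmove u w).1 huw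
    exact ⟨p, hp, hsrc p hp, by rw [hdst p hp, if_pos hc.symm]⟩
  have hres₁ := h₃.result
  rw [hE] at hres₁
  have hres₂ := h₄.result
  rw [h₃.arr_eq 1 (by omega), h₃.arr_eq 6 (by omega), arrayArc_swap, hE] at hres₂
  have hres₃ := h₅.result
  rw [h₄.arr_eq 7 (by omega), h₄.arr_eq 6 (by omega), h₃.arr_eq 7 (by omega),
    h₃.arr_eq 6 (by omega), arrayArc_swap, ← hE₀] at hres₃
  have hres₄ := h₆.result
  rw [h₅.arr_eq 7 (by omega), h₅.arr_eq 6 (by omega), h₄.arr_eq 7 (by omega),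
    h₄.arr_eq 6 (by omega), h₃.arr_eq 7 (by omega), h₃.arr_eq 6 (by omega), ← hE₀] at hres₄
  have hlow : ∀ v, σ₆.arr 5 v - σ₆.arr 32 v = low D a v := by
    intro v
    have hmem : v ∈ F₃ ↔ ∃ b, Reach D a v b ∧ count a b < count a v := by
      rw [exists_reach_count_lt_iff hopt hE₀1 hE₀2, hres₃.mem_iff]
      constructor
      · rintro ⟨u, hu, huv⟩
        obtain ⟨p, hp, h1, h2⟩ := (hup u).1 hu
        exact ⟨u, _, reflTransGen_swap.1 huv, (hmove _ _).2 ⟨p, hp, h1, rfl⟩, h2⟩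
      · rintro ⟨u, w, huv, huw, hlt⟩
        obtain ⟨p, hp, h1, rfl⟩ := (hmove _ _).1 huw
        exact ⟨u, (hup u).2 ⟨p, hp, h1, hlt⟩, reflTransGen_swap.2 huv⟩
    rw [low, harr₆ 5 (by norm_num), harr₂ 5 (by omega), h₁.counts, hcount,
      h₆.arr_eq 32 (by omega), sub_right_inj]
    split_ifs with hif
    · exact h₅.seen v (hmem.2 hif)
    · exact h₅.unseen v (mt hmem.1 hif)
  have hhigh : ∀ v, σ₆.arr 5 v + σ₆.arr 42 v = high D a v := by
    intro v
    have hmem : v ∈ F₄ ↔ ∃ b, Reach D a b v ∧ count a v < count a b := by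
      rw [exists_reach_count_gt_iff hopt hE₀1 hE₀2, hres₄.mem_iff]
      constructor
      · rintro ⟨w, hw, hwv⟩
        obtain ⟨p, hp, h1, h2⟩ := (hdown w).1 hw
        exact ⟨_, w, hwv, (hmove _ _).2 ⟨p, hp, rfl, h1⟩, h2⟩
      · rintro ⟨u, w, hwv, huw, hlt⟩
        obtain ⟨p, hp, rfl, h1⟩ := (hmove _ _).1 huw
        exact ⟨w, (hdown w).2 ⟨p, hp, h1, hlt⟩, hwv⟩
    rw [high, harr₆ 5 (by norm_num), harr₂ 5 (by omega), h₁.counts, hcount, add_right_inj]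
    split_ifs with hif
    · exact h₆.seen v (hmem.2 hif)
    · exact h₆.unseen v (mt hmem.1 hif)
  have hroot : ∀ p : ℕ, p < m → σ₀.arr 1 p ∈ F₁ := fun p hp =>
    hres₁.root_mem _ (List.mem_map.2 ⟨p, List.mem_range.2 hp, rfl⟩)
  refine ⟨_, σ₇, .seq hex₁ (.seq hex₂ (.seq hex₃ (.seq hex₄ (.seq hex₅ (.seq hex₆ hex₇))))),
    ?_, ?_, fun p hp => ?_⟩
  -- The searches have `m`, at most `2 * m`, and twice at most `m` roots, so every loop is linear in
  -- `m`.
  · have hlen := h₃.length_le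
    have hlen' : down.length = up.length := by omega
    simp only [List.length_map, List.length_range, Expr.time] at hlen hT₃ hT₄ hT₅ hT₆
    omega
  · rw [h₇.reg_eq 4 (by norm_num), hmu]
  · have hd : σ₆.arr 1 = σ₀.arr 1 := by rw [harr₆ 1 (by norm_num), h21]
    have ha : σ₆.arr 6 p = A (σ₀.arr 0 p) := by rw [harr₆ 6 (by norm_num), hsrc p hp]
    have hcomp : σ₆.arr 23 = σ₄.arr 23 := by rw [h₆.arr_eq 23 (by omega), h₅.arr_eq 23 (by omega)]
    obtain ⟨q, hq, hqA⟩ := hval p hp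
    rw [h₇.keeps p hp, Keeps, hd, ha, hlow, hhigh, hmu, hreg₆ 3 (by norm_num) (by norm_num), hcomp,
      hres₁.lab_eq_iff hres₂ (hroot p hp) (hqA ▸ hroot q hq), and_iff_left]
    -- The pair is itself a move from the assigned value to its own value, so sharing a component
    -- reduces to the opposite direction.
    exact .single ((hmove _ _).2 ⟨p, hp, rfl, rfl⟩)

end Correctness

/-! ### From the final memory back to the constraint -/

section Main

variable {n : ℕ} {D : Fin n → Finset ℤ}

theorem pairCount_eq {σ₀ : State} {A : ℤ → ℤ} {a : Fin n → ℤ} (ha : ∀ i, a i ∈ D i)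
    (enum : Fin (size D) ≃ VarArc D)
    (h : ∀ p : Fin (size D), σ₀.arr 1 (p : ℕ) = (enum p).2 ∧ A (σ₀.arr 0 (p : ℕ)) = a (enum p).1) :
    pairCount σ₀ A (size D) = count a := by
  funext v
  rw [pairCount, ← Fin.sum_univ_eq_sum_range
    (fun p => if σ₀.arr 1 p = A (σ₀.arr 0 p) ∧ σ₀.arr 1 p = v then (1 : ℤ) else 0)]
  rw [Finset.sum_congr rfl fun p _ => by rw [(h p).1, (h p).2],
    Equiv.sum_comp enum fun q : VarArc D => if (q.2 : ℤ) = a q.1 ∧ (q.2 : ℤ) = v then (1 : ℤ) else 0,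
    Fintype.sum_sigma, count]
  refine Finset.sum_congr rfl fun i _ => ?_
  rw [Finset.sum_eq_single ⟨a i, ha i⟩
    (fun d _ hd => if_neg fun h => hd (Subtype.ext h.1)) (by simp)]
  simp

/-- A reduction of the domains that keeps exactly the values of the tuples of the constraint
is hyper-arc consistent and keeps the tuples. -/
theorem hyperArcConsistent_of_mem_iff {Dz : Finset ℤ} {D' : Fin n → Finset ℤ} {Dz' : Finset ℤ}
    (hD : ∀ j d, d ∈ softDomains D' Dz' j ↔ ∃ τ ∈ softAllDiff D Dz, τ j = d) :
    HyperArcConsistent (softDomains D' Dz') (softAllDiff D' Dz') ∧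
      softAllDiff D' Dz' = softAllDiff D Dz := by
  have hsub : ∀ j d, d ∈ softDomains D' Dz' j → d ∈ softDomains D Dz j := by
    intro j d hd
    obtain ⟨τ, hτ, rfl⟩ := (hD j d).1 hd
    exact hτ.1 j
  have heq : softAllDiff D' Dz' = softAllDiff D Dz := by
    ext τ
    exact ⟨fun h => ⟨fun j => hsub j _ (h.1 j), h.2⟩, fun h => ⟨fun j => (hD j _).2 ⟨τ, h, rfl⟩, h.2⟩⟩
  refine ⟨fun j d hd => ?_, heq⟩
  obtain ⟨τ, hτ, hj⟩ := (hD j d).1 hd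
  exact ⟨τ, heq ▸ hτ, hj, fun k => (hD k _).2 ⟨τ, hτ, rfl⟩⟩

/-- Raising `z` keeps a tuple valid, so only the greatest value of its domain matters to the other
variables. -/
theorem exists_mem_softAllDiff_some {Dz : Finset ℤ} {zmax : ℤ} (hz : IsGreatest (Dz : Set ℤ) zmax)
    (i : Fin n) (d : ℤ) : (∃ τ ∈ softAllDiff D Dz, τ (some i) = d) ↔
      ∃ τ : Fin n → ℤ, (∀ j, τ j ∈ D j) ∧ τ i = d ∧ (violation τ : ℤ) ≤ zmax := by
  constructor
  · rintro ⟨τ, ⟨h1, h2⟩, h3⟩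
    exact ⟨fun j => τ (some j), fun j => h1 (some j), h3, h2.trans (hz.2 (h1 none))⟩
  · rintro ⟨τ, h1, h2, h3⟩
    refine ⟨fun j => j.elim zmax τ, ⟨fun j => ?_, h3⟩, h2⟩
    rcases j with _ | j
    · exact hz.1
    · exact h1 j

theorem exists_mem_softAllDiff_none {Dz : Finset ℤ} {a : Fin n → ℤ} (ha : IsOptimal D a)
    (z : ℤ) : (∃ τ ∈ softAllDiff D Dz, τ none = z) ↔ z ∈ Dz ∧ (violation a : ℤ) ≤ z := by
  constructor
  · rintro ⟨τ, ⟨h1, h2⟩, rfl⟩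
    refine ⟨h1 none, le_trans ?_ h2⟩
    exact_mod_cast ha.le _ fun j => h1 (some j)
  · rintro ⟨h1, h2⟩
    refine ⟨fun j => j.elim z a, ⟨fun j => ?_, h2⟩, rfl⟩
    rcases j with _ | j
    · exact h1
    · exact ha.mem j

theorem mem_outputDomains {enum : Fin (size D) ≃ VarArc D} {σ : State} {i : Fin n} {d : ℤ} :
    d ∈ outputDomains D enum σ i ↔
      ∃ h : d ∈ D i, σ.arr 3 ((enum.symm ⟨i, d, h⟩ : ℕ) : ℤ) = 1 := by
  simp [outputDomains]

end Main

end SoftAllDiff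

open SoftAllDiff
theorem theorem6 :
    ∃ (prog : Program) (K : ℕ),
      ∀ (n : ℕ) (D : Fin n → Finset ℤ) (Dz : Finset ℤ) (zmin zmax : ℤ)
        (f : Arc D → ℤ) (enum : Fin (size D) ≃ VarArc D),
        IsLeast (Dz : Set ℤ) zmin →
        IsGreatest (Dz : Set ℤ) zmax →
        (softAllDiff D Dz).Nonempty →
        (network D).IsMinCostFlow (fun a => (f a : ℝ)) →
        ∃ (T : ℕ) (σ : State),
          Exec prog (inputState D zmin zmax f enum) T σ ∧
          T ≤ K * (size D + 1) ∧
          HyperArcConsistent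
            (softDomains (outputDomains D enum σ) (outputCostDomain Dz σ))
            (softAllDiff (outputDomains D enum σ) (outputCostDomain Dz σ)) ∧
          softAllDiff (outputDomains D enum σ) (outputCostDomain Dz σ) = softAllDiff D Dz := by
  refine ⟨propagate, 4000, fun n D Dz zmin zmax f enum _ hz hne hf => ?_⟩
  obtain ⟨τ₀, hτ₀, hv₀⟩ := hne
  obtain ⟨a, hopt, hfa⟩ := exists_isOptimal_of_isMinCostFlow (D := D) (fun i => ⟨_, hτ₀ (some i)⟩) hf
  set σ₀ := inputState D zmin zmax f enum with hσ₀
  -- The machine stores indices of variables as integers, so `a` is extended to `ℤ`; the default `0`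
  -- is never consulted for an input pair.
  obtain ⟨A, hA⟩ : ∃ A : ℤ → ℤ, ∀ i : Fin n, A ((i : ℕ) : ℤ) = a i :=
    ⟨fun z => if h : z.toNat < n then a ⟨z.toNat, h⟩ else 0, fun i => by simp⟩
  have harr : ∀ p : Fin (size D), σ₀.arr 0 (p : ℕ) = ((enum p).1 : ℕ) ∧
      σ₀.arr 1 (p : ℕ) = (enum p).2 ∧ σ₀.arr 2 (p : ℕ) = f (varArc D (enum p)) := by
    intro p
    simp [hσ₀, inputState]
  have hpair : ∀ p : Fin (size D), σ₀.arr 1 (p : ℕ) = (enum p).2 ∧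
      A (σ₀.arr 0 (p : ℕ)) = a (enum p).1 :=
    fun p => ⟨(harr p).2.1, by rw [(harr p).1, hA]⟩
  have hinput : IsInput σ₀ (size D) A := by
    constructor
    · rfl
    · intro r hr
      obtain ⟨r, rfl⟩ := Nat.exists_eq_add_of_le' hr
      rfl
    · intro x hx
      obtain ⟨x, rfl⟩ := Nat.exists_eq_add_of_le' hx
      funext p
      simp [hσ₀, inputState]
    · intro p hp
      obtain ⟨h1, h2⟩ := hpair ⟨p, hp⟩
      simp only at h1 h2
      rw [h1, h2, (harr ⟨p, hp⟩).2.2, hfa]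
      split_ifs with h <;> simp [h]
    · intro p hp
      refine ⟨enum.symm ⟨(enum ⟨p, hp⟩).1, a (enum ⟨p, hp⟩).1, hopt.mem _⟩, Fin.is_lt _, ?_, ?_⟩
      · rw [(harr _).1, (harr ⟨p, hp⟩).1, Equiv.apply_symm_apply]
      · rw [(hpair _).1, (hpair ⟨p, hp⟩).2, Equiv.apply_symm_apply]
  have hmove : ∀ u w, Move D a u w ↔
      ∃ p : ℕ, p < size D ∧ A (σ₀.arr 0 p) = u ∧ σ₀.arr 1 p = w := by
    intro u w
    constructor
    · rintro ⟨i, rfl, hw⟩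
      refine ⟨enum.symm ⟨i, w, hw⟩, Fin.is_lt _, ?_, ?_⟩
      · rw [(hpair _).2, Equiv.apply_symm_apply]
      · rw [(hpair _).1, Equiv.apply_symm_apply]
    · rintro ⟨p, hp, rfl, rfl⟩
      refine ⟨(enum ⟨p, hp⟩).1, (hpair ⟨p, hp⟩).2.symm, ?_⟩
      rw [(hpair ⟨p, hp⟩).1]
      exact (enum ⟨p, hp⟩).2.2
  obtain ⟨T, σ, hex, hT, hmu, hkeep⟩ :=
    exec_propagate hopt hinput hmove (pairCount_eq hopt.mem enum hpair)
  refine ⟨T, σ, hex, hT, hyperArcConsistent_of_mem_iff ?_⟩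
  -- Consistency enters here: the least violation is within the bound, so every pair inside a
  -- component is supported.
  have hB : (violation a : ℤ) ≤ zmax := by
    refine le_trans ?_ (hv₀.trans (hz.2 (hτ₀ none)))
    exact_mod_cast hopt.le _ fun j => hτ₀ (some j)
  rintro (_ | i) d
  · rw [exists_mem_softAllDiff_none hopt]
    simp [softDomains, outputCostDomain, hmu]
  · rw [exists_mem_softAllDiff_some hz, softDomains, mem_outputDomains]
    have hiff : ∀ hd : d ∈ D i, (σ.arr 3 ((enum.symm ⟨i, d, hd⟩ : ℕ) : ℤ) = 1 ↔
        ∃ τ : Fin n → ℤ, (∀ j, τ j ∈ D j) ∧ τ i = d ∧ (violation τ : ℤ) ≤ zmax) := by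
      intro hd
      rw [exists_violation_le_iff hopt hd hB, hkeep _ (Fin.is_lt _), (hpair _).1, (hpair _).2,
        Equiv.apply_symm_apply]
      rfl
    constructor
    · rintro ⟨hd, h⟩
      exact (hiff hd).1 h
    · rintro ⟨τ, h1, rfl, h2⟩
      exact ⟨h1 i, (hiff (h1 i)).2 ⟨τ, h1, rfl, h2⟩⟩
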